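/- An abstract spin chain consists of a unital C*-algebra $A$ and an inclusion-preserving assignment $I\mapsto A_I$ of a finite-dimensional $*$-subalgebra $A_I\subseteq A$ containing $1_A$ to every finite nonempty interval $I\subseteq\mathbb Z$, such that $[A_I,A_J]=0$ whenever $I\cap J=\varnothing$ and $\bigcup_I A_I$ is norm dense in $A$. A quantum cellular automaton (QCA) is a $*$-automorphism $\alpha$ of $A$ for which there is an integer $l\ge 0$ with $\alpha(A_{[a,b]})\subseteq A_{[a-l,b+l]}$ and $\alpha^{-1}(A_{[a,b]})\subseteq A_{[a-l,b+l]}$ for all intervals $[a,b]$; these form a group $\mathrm{QCA}(A)$. A depth one circuit is an automorphism $\alpha$ with $\alpha(w)=\big(\prod_i u_i\big)w\big(\prod_i u_i^*\big)$ for all $w\in\bigcup_I A_I$, where $\{I_i\}_{i\in\mathbb N}$ is a partition of $\mathbb Z$ into intervals of bounded length and $u_i\in A_{I_i}$ are unitaries (only finitely many $u_i$ fail to commute with a given $w$). The finite compositions of depth one circuits form the subgroup $\mathrm{FDQC}(A)\subseteq\mathrm{QCA}(A)$. Suppose that $A$ has a unique tracial state $\mathrm{tr}$. For $x\in\mathbb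 Z$ let $\mathcal A_x:=\big(\bigcup_{I\subseteq(-\infty,x]}A_I\big)''\subseteq B(L^2(A,\mathrm{tr}))$, in the GNS representation of $\mathrm{tr}$. Every QCA $\alpha$ preserves $\mathrm{tr}$ and hence extends uniquely to an automorphism, still denoted $\alpha$, of $\mathcal A:=A''\subseteq B(L^2(A,\mathrm{tr}))$. For an inclusion $N\subseteq M$ of $\mathrm{II}_1$ factors let $[M:N]=\dim_N L^2(M)$ (Murray–von Neumann dimension) denote the Jones index. Suppose that $A$ has the (left) finite index property: every $\mathcal A_x$ is an infinite-dimensional factor, and $[\mathcal A_z:\mathcal A_x]<\infty$ for all $x<z$. **Theorem.** For every QCA $\alpha$ and every $x\in\mathbb Z$ there is $y\le x$ with $\mathcal A_y\subseteq\alpha(\mathcal A_x)$. For all integers $y\le x$ with $\mathcal A_y\subseteq\alpha(\mathcal A_x)$, the indices $[\alpha(\mathcal A_x):\mathcal A_y]$ and $[\mathcal A_x:\mathcal A_y]$ are finite, and the number $$\mathrm{ind}(\alpha)=\left(\frac{[\alpha(\mathcal A_x):\mathcal A_y]}{[\mathcal A_x:\mathcal A_y]}\right)^{1/2}$$ is positive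 and does not depend on the choice of such $x$ and $y$. The map $\mathrm{ind}:\mathrm{QCA}(A)\to\mathbb R^\times_+$ is a group homomorphism, and its kernel contains $\mathrm{FDQC}(A)$. -/

import Mathlib

open scoped ComplexOrder InnerProductSpace ENNReal

noncomputable section

namespace QCAIndex

/-! ### The Jones index -/

section JonesIndex

variable {H : Type*} [NormedAddCommGroup H] [InnerProductSpace ℂ H] [CompleteSpace H]

/-- The von Neumann algebra `(S ∪ S*)''` generated by a set `S` of bounded operators
(this is `S''` when `S` is closed under adjoints). -/
def vonNeumannGenerated (S : Set (H →L[ℂ] H)) : VonNeumannAlgebra H :=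
  VonNeumannAlgebra.commutant
    { toStarSubalgebra := StarSubalgebra.centralizer ℂ S
      centralizer_centralizer' := by
        change Set.centralizer (Set.centralizer
          ((StarSubalgebra.centralizer ℂ S : StarSubalgebra ℂ (H →L[ℂ] H)) : Set (H →L[ℂ] H)))
            = ((StarSubalgebra.centralizer ℂ S : StarSubalgebra ℂ (H →L[ℂ] H)) :
              Set (H →L[ℂ] H))
        rw [StarSubalgebra.coe_centralizer, Set.centralizer_centralizer_centralizer] }

/-- The image of a von Neumann algebra on `H` under a `*`-automorphism of `B(H)`. -/
def vonNeumannMap (φ : (H →L[ℂ] H) ≃⋆ₐ[ℂ] (H →L[ℂ] H)) (M : VonNeumannAlgebra H) :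
    VonNeumannAlgebra H where
  toStarSubalgebra := M.toStarSubalgebra.map (StarAlgHomClass.toStarAlgHom φ)
  centralizer_centralizer' := by
    change Set.centralizer (Set.centralizer (φ '' (M : Set (H →L[ℂ] H)))) = φ '' M
    have key : ∀ S : Set (H →L[ℂ] H), Set.centralizer (φ '' S) = φ '' Set.centralizer S := by
      intro S
      ext T
      constructor
      · intro hT
        refine ⟨φ.symm T, fun s hs => EquivLike.injective φ ?_, by simp⟩
        have := hT (φ s) ⟨s, hs, rfl⟩
        simpa using this
      · rintro ⟨R, hR, rfl⟩ _ ⟨s, hs, rfl⟩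
        rw [← map_mul, ← map_mul, hR s hs]
    rw [key, key, M.centralizer_centralizer]

/-- `M` is a factor: its center consists of the scalars. -/
def IsFactor (M : VonNeumannAlgebra H) : Prop :=
  ∀ T ∈ M, T ∈ M.commutant → ∃ c : ℂ, T = c • (1 : H →L[ℂ] H)

/-- For a unit vector `Ω` whose vector state `⟨Ω, · Ω⟩` is a trace on `M`, this is the Hilbert
space `L²(M)` of that trace, realized inside `H` as the closure of `M Ω`. -/
abbrev L2 (M : VonNeumannAlgebra H) (Ω : H) : Submodule ℂ H :=
  (Submodule.map (ContinuousLinearMap.apply ℂ H Ω : (H →L[ℂ] H) →L[ℂ] H).toLinearMap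
    (Subalgebra.toSubmodule M.toStarSubalgebra.toSubalgebra)).topologicalClosure

theorem trace_vector_mem_L2 (M : VonNeumannAlgebra H) (Ω : H) : Ω ∈ L2 M Ω :=
  Submodule.le_topologicalClosure _ ⟨1, one_mem M.toStarSubalgebra, by simp⟩

/-- The Murray–von Neumann dimension over `N` of a closed `N`-invariant subspace `K` of `H`,
where `Ω` is a unit vector that gives the trace of the `II₁` factor `N`.

For an `N`-linear isometry `v : K → L²(N) ⊗ ℓ²(ℕ)`, the projection `v v*` lies in the commutant
of `N` on `L²(N) ⊗ ℓ²(ℕ)`, and the dimension is its trace there,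
`(tr ⊗ Tr) (v v*) = ∑ i, ⟨Ω ⊗ e i, v v* (Ω ⊗ e i)⟩ = ∑ i, ‖v* (Ω ⊗ e i)‖ ^ 2`.
This number is the same for all `v`, and the infimum over `v` only selects it. -/
def murrayVonNeumannDim (N : VonNeumannAlgebra H) (Ω : H) (K : Submodule ℂ H)
    [CompleteSpace K] : ℝ≥0∞ :=
  ⨅ (v : K →ₗᵢ[ℂ] lp (fun _ : ℕ => L2 N Ω) 2)
    (_ : ∀ n ∈ N, ∀ ξ η : K, (η : H) = n (ξ : H) →
      ∀ i : ℕ, ((v η i : L2 N Ω) : H) = n ((v ξ i : L2 N Ω) : H)),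
    ∑' i : ℕ, ‖ContinuousLinearMap.adjoint v.toContinuousLinearMap
      (lp.single 2 i (⟨Ω, trace_vector_mem_L2 N Ω⟩ : L2 N Ω))‖ₑ ^ 2

/-- The Jones index `[M : N] = dim_N L²(M)` of an inclusion `N ⊆ M` of `II₁` factors on `H`
whose traces are given by the unit vector `Ω`. -/
def jonesIndex (Ω : H) (M N : VonNeumannAlgebra H) : ℝ≥0∞ :=
  murrayVonNeumannDim N Ω (L2 M Ω)

end JonesIndex

/-! ### Tracial states -/

section Trace

variable {A : Type*} [CStarAlgebra A] [PartialOrder A] [StarOrderedRing A]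

/-- A tracial state. -/
structure IsTracialState (τ : A →ₚ[ℂ] ℂ) : Prop where
  map_one : τ 1 = 1
  map_mul_comm : ∀ a b, τ (a * b) = τ (b * a)

/-- `τ` is the unique tracial state. -/
structure IsUniqueTracialState (τ : A →ₚ[ℂ] ℂ) : Prop extends IsTracialState τ where
  unique : ∀ σ : A →ₚ[ℂ] ℂ, IsTracialState σ → σ = τ

/-- A `*`-automorphism preserves the unique tracial state. -/
theorem IsUniqueTracialState.map_apply {τ : A →ₚ[ℂ] ℂ} (h : IsUniqueTracialState τ)
    (α : A ≃⋆ₐ[ℂ] A) (a : A) : τ (α a) = τ a := by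
  have hmono : Monotone α := (OrderHomClass.mono (α : A →⋆ₐ[ℂ] A))
  let σ : A →ₚ[ℂ] ℂ :=
    { toFun := fun a => τ (α a)
      map_add' := by simp
      map_smul' := by simp
      monotone' := fun x y hxy => OrderHomClass.mono τ (hmono hxy) }
  have hσ : IsTracialState σ :=
    ⟨by change τ (α 1) = 1; rw [map_one, h.map_one], fun x y => by
      change τ (α (x * y)) = τ (α (y * x))
      rw [map_mul α, map_mul α, h.map_mul_comm]⟩
  exact DFunLike.congr_fun (h.unique σ hσ) a

/-- The class of `1` in `L²(A, τ)`. -/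
def gnsVector (τ : A →ₚ[ℂ] ℂ) : τ.GNS := ((τ.toPreGNS 1 : τ.PreGNS) : τ.GNS)

/-- A trace preserving `*`-automorphism `α` as an isometry `a ↦ α a` for the `L²`-seminorm. -/
def preGNSIsometry (τ : A →ₚ[ℂ] ℂ) (α : A ≃⋆ₐ[ℂ] A) (h : ∀ a, τ (α a) = τ a) :
    τ.PreGNS →ₗᵢ[ℂ] τ.PreGNS where
  toFun x := τ.toPreGNS (α (τ.ofPreGNS x))
  map_add' := by simp
  map_smul' := by simp
  norm_map' x := by
    change ‖τ.toPreGNS (α (τ.ofPreGNS x))‖ = ‖x‖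
    rw [τ.preGNS_norm_def, τ.preGNS_norm_def, τ.ofPreGNS_toPreGNS, ← map_star, ← map_mul, h]

/-- The unitary on `L²(A, τ)` that extends `a ↦ α a`. -/
def gnsUnitary (τ : A →ₚ[ℂ] ℂ) (hτ : IsUniqueTracialState τ) (α : A ≃⋆ₐ[ℂ] A) :
    τ.GNS ≃ₗᵢ[ℂ] τ.GNS where
  toFun := (preGNSIsometry τ α (hτ.map_apply α)).toContinuousLinearMap.completion
  map_add' := map_add _
  map_smul' := map_smul _
  invFun := (preGNSIsometry τ α.symm (hτ.map_apply α.symm)).toContinuousLinearMap.completion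
  left_inv x := by
    induction x using UniformSpace.Completion.induction_on with
    | hp => apply isClosed_eq <;> fun_prop
    | ih a => simp [preGNSIsometry]
  right_inv x := by
    induction x using UniformSpace.Completion.induction_on with
    | hp => apply isClosed_eq <;> fun_prop
    | ih a => simp [preGNSIsometry]
  norm_map' x := by
    change ‖(preGNSIsometry τ α (hτ.map_apply α)).toContinuousLinearMap.completion x‖ = ‖x‖
    induction x using UniformSpace.Completion.induction_on with
    | hp => apply isClosed_eq <;> fun_prop
    | ih a => simp

/-- Conjugation by the unitary of `α`. It extends `α` (see `extend_gns`), and it restricts to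
the automorphism of the von Neumann algebra `A''` on `L²(A, τ)` that extends `α`. -/
def extend (τ : A →ₚ[ℂ] ℂ) (hτ : IsUniqueTracialState τ) (α : A ≃⋆ₐ[ℂ] A) :
    (τ.GNS →L[ℂ] τ.GNS) ≃⋆ₐ[ℂ] (τ.GNS →L[ℂ] τ.GNS) :=
  (gnsUnitary τ hτ α).conjStarAlgEquiv

theorem extend_gns (τ : A →ₚ[ℂ] ℂ) (hτ : IsUniqueTracialState τ) (α : A ≃⋆ₐ[ℂ] A) (a : A) :
    extend τ hτ α (τ.gnsStarAlgHom a) = τ.gnsStarAlgHom (α a) := by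
  ext x
  obtain ⟨y, rfl⟩ := (gnsUnitary τ hτ α).surjective x
  change gnsUnitary τ hτ α (τ.gnsStarAlgHom a ((gnsUnitary τ hτ α).symm _)) = _
  rw [LinearIsometryEquiv.symm_apply_apply]
  change (preGNSIsometry τ α (hτ.map_apply α)).toContinuousLinearMap.completion
    (τ.gnsNonUnitalStarAlgHom a y) = τ.gnsNonUnitalStarAlgHom (α a)
      ((preGNSIsometry τ α (hτ.map_apply α)).toContinuousLinearMap.completion y)
  induction y using UniformSpace.Completion.induction_on with
  | hp => apply isClosed_eq <;> fun_prop
  | ih b => simp [preGNSIsometry]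

end Trace

/-! ### Abstract spin chains, quantum cellular automata, circuits -/

/-- The interval `[a - l, b + l]` for `I = [a, b]`. -/
def enlarge (I : NonemptyInterval ℤ) (l : ℕ) : NonemptyInterval ℤ :=
  ⟨(I.fst - l, I.snd + l), by have := I.fst_le_snd; change I.fst - l ≤ I.snd + l; omega⟩

/-- An abstract spin chain with quasi-local algebra `A`. -/
structure SpinChain (A : Type*) [CStarAlgebra A] where
  /-- The algebra of a finite nonempty interval; all of them contain the unit of `A`. -/
  alg : NonemptyInterval ℤ →o StarSubalgebra ℂ A
  finiteDimensional : ∀ I, FiniteDimensional ℂ (alg I)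
  locality : ∀ I J : NonemptyInterval ℤ, Disjoint (I : Set ℤ) (J : Set ℤ) →
    ∀ a ∈ alg I, ∀ b ∈ alg J, a * b = b * a
  dense : Dense (⋃ I, (alg I : Set A))

namespace SpinChain

section Circuits

variable {A : Type*} [CStarAlgebra A] (S : SpinChain A)

/-- `α` and its inverse spread every interval by at most `l`. -/
def HasSpread (α : A ≃⋆ₐ[ℂ] A) (l : ℕ) : Prop :=
  ∀ I : NonemptyInterval ℤ, ∀ a ∈ S.alg I,
    α a ∈ S.alg (enlarge I l) ∧ α⁻¹ a ∈ S.alg (enlarge I l)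

/-- The group of quantum cellular automata. -/
def QCA : Subgroup (A ≃⋆ₐ[ℂ] A) where
  carrier := {α | ∃ l, S.HasSpread α l}
  one_mem' := ⟨0, fun I a ha => by
    have : enlarge I 0 = I := by
      apply NonemptyInterval.ext; simp [enlarge]
    rw [this]; exact ⟨ha, by simpa using ha⟩⟩
  inv_mem' := by
    rintro α ⟨l, h⟩
    exact ⟨l, fun I a ha => ⟨(h I a ha).2, by simpa using (h I a ha).1⟩⟩
  mul_mem' := by
    rintro α β ⟨l, hα⟩ ⟨m, hβ⟩
    refine ⟨l + m, fun I a ha => ⟨?_, ?_⟩⟩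
    · have := (hα _ _ (hβ I a ha).1).1
      have e : enlarge (enlarge I m) l = enlarge I (l + m) := by
        apply NonemptyInterval.ext; ext <;> simp [enlarge] <;> ring
      rw [← e]; exact this
    · have := (hβ _ _ (hα I a ha).2).2
      have e : enlarge (enlarge I l) m = enlarge I (l + m) := by
        apply NonemptyInterval.ext; ext <;> simp [enlarge] <;> ring
      rw [← e, mul_inv_rev]; exact this

/-- The intervals `I i` form a partition of `ℤ` with bounded lengths, and `u i` is a unitary
in the algebra of `I i`. -/
structure IsCircuitLayer (I : ℕ → NonemptyInterval ℤ) (u : ℕ → A) : Prop where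
  disjoint : ∀ i j, i ≠ j → Disjoint (I i : Set ℤ) (I j : Set ℤ)
  cover : ∀ k : ℤ, ∃ i, k ∈ I i
  bounded : ∃ l : ℕ, ∀ i, (I i).snd - (I i).fst ≤ l
  mem : ∀ i, u i ∈ S.alg (I i)
  unitary : ∀ i, u i ∈ unitary A

/-- `u 0 * u 1 * ⋯ * u (n - 1)`. -/
def partialProduct (u : ℕ → A) (n : ℕ) : A := ((List.range n).map u).prod

/-- `α w = (∏ i, u i) w (∏ i, u i)*` for all local `w`. The `u i` commute with each other, and
all but finitely many of them commute with `w`, so the right-hand side is the eventually constant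
value of `(∏ i < n, u i) w (∏ i < n, u i)*`. -/
def IsDepthOneCircuit (α : A ≃⋆ₐ[ℂ] A) : Prop :=
  ∃ (I : ℕ → NonemptyInterval ℤ) (u : ℕ → A), S.IsCircuitLayer I u ∧
    ∀ J : NonemptyInterval ℤ, ∀ w ∈ S.alg J, ∀ᶠ n in Filter.atTop,
      α w = partialProduct u n * w * star (partialProduct u n)

/-- `α` is a composition of finitely many depth one circuits. -/
def IsFiniteDepthCircuit (α : A ≃⋆ₐ[ℂ] A) : Prop :=
  ∃ L : List (A ≃⋆ₐ[ℂ] A), (∀ β ∈ L, S.IsDepthOneCircuit β) ∧ L.prod = α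

variable {S}

theorem partialProduct_succ (u : ℕ → A) (n : ℕ) :
    partialProduct u (n + 1) = partialProduct u n * u n := by
  simp [partialProduct, List.range_succ]

theorem IsCircuitLayer.commute_partialProduct {I : ℕ → NonemptyInterval ℤ} {u : ℕ → A}
    (h : S.IsCircuitLayer I u) {n m : ℕ} (hnm : n ≤ m) : Commute (u m) (partialProduct u n) := by
  induction n with
  | zero => simp [partialProduct]
  | succ n ih =>
    rw [partialProduct_succ]
    exact (ih (by omega)).mul_right
      (S.locality _ _ (h.disjoint m n (by omega)) _ (h.mem m) _ (h.mem n))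

theorem IsCircuitLayer.partialProduct_mem_unitary {I : ℕ → NonemptyInterval ℤ} {u : ℕ → A}
    (h : S.IsCircuitLayer I u) (n : ℕ) : partialProduct u n ∈ _root_.unitary A := by
  induction n with
  | zero => simp [partialProduct]
  | succ n ih =>
    rw [partialProduct_succ]
    exact mul_mem ih (h.unitary n)

theorem IsCircuitLayer.star {I : ℕ → NonemptyInterval ℤ} {u : ℕ → A}
    (h : S.IsCircuitLayer I u) : S.IsCircuitLayer I (fun i => star (u i)) where
  disjoint := h.disjoint
  cover := h.cover
  bounded := h.bounded
  mem i := star_mem (h.mem i)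
  unitary i := Unitary.star_mem (h.unitary i)

theorem IsCircuitLayer.partialProduct_star {I : ℕ → NonemptyInterval ℤ} {u : ℕ → A}
    (h : S.IsCircuitLayer I u) (n : ℕ) :
    partialProduct (fun i => Star.star (u i)) n = Star.star (partialProduct u n) := by
  induction n with
  | zero => simp [partialProduct]
  | succ n ih =>
    rw [partialProduct_succ, partialProduct_succ, ih,
      ← (h.commute_partialProduct le_rfl).eq, star_mul]

/-- All but finitely many of the unitaries commute with a local operator. -/
theorem IsCircuitLayer.exists_forall_commute {I : ℕ → NonemptyInterval ℤ} {u : ℕ → A}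
    (h : S.IsCircuitLayer I u) (J : NonemptyInterval ℤ) :
    ∃ n, ∀ m ≥ n, ∀ w ∈ S.alg J, Commute (u m) w := by
  choose f hf using h.cover
  obtain ⟨n, hn⟩ := ((Set.finite_Icc J.fst J.snd).image f).bddAbove
  refine ⟨n + 1, fun m hm w hw => S.locality _ _ ?_ _ (h.mem m) _ hw⟩
  rw [Set.disjoint_left]
  intro k hk hkJ
  have hfm : f k = m := by
    by_contra hne
    exact Set.disjoint_left.mp (h.disjoint _ _ hne) (hf k) hk
  have := hn ⟨k, hkJ, rfl⟩
  omega

theorem IsCircuitLayer.exists_mem_conj {I : ℕ → NonemptyInterval ℤ} {u : ℕ → A}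
    (h : S.IsCircuitLayer I u) (n : ℕ) {J : NonemptyInterval ℤ} {w : A} (hw : w ∈ S.alg J) :
    ∃ J', partialProduct u n * w * Star.star (partialProduct u n) ∈ S.alg J' := by
  induction n with
  | zero => exact ⟨J, by simpa [partialProduct] using hw⟩
  | succ n ih =>
    obtain ⟨J', hJ'⟩ := ih
    refine ⟨J' ⊔ I n, ?_⟩
    have hu := S.alg.monotone (le_sup_right : I n ≤ J' ⊔ I n) (h.mem n)
    have hc := S.alg.monotone (le_sup_left : J' ≤ J' ⊔ I n) hJ'
    rw [partialProduct_succ, ← (h.commute_partialProduct le_rfl).eq, star_mul]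
    have := mul_mem (mul_mem hu hc) (star_mem hu)
    simpa only [mul_assoc] using this

/-- The inverse of a depth one circuit is the depth one circuit of the adjoint unitaries. -/
theorem IsDepthOneCircuit.inv {α : A ≃⋆ₐ[ℂ] A} (hα : S.IsDepthOneCircuit α) :
    S.IsDepthOneCircuit α⁻¹ := by
  obtain ⟨I, u, h, hconj⟩ := hα
  refine ⟨I, fun i => Star.star (u i), h.star, fun J w hw => ?_⟩
  obtain ⟨n₀, hn₀⟩ := h.exists_forall_commute J
  have hstab : ∀ m ≥ n₀, Star.star (partialProduct u m) * w * partialProduct u m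
      = Star.star (partialProduct u n₀) * w * partialProduct u n₀ := by
    intro m hm
    induction m, hm using Nat.le_induction with
    | base => rfl
    | succ m hm ih =>
      rw [← ih, partialProduct_succ, ← (h.commute_partialProduct le_rfl).eq, star_mul]
      have hc : Star.star (u m) * w * u m = w := by
        rw [mul_assoc, ← (hn₀ m hm w hw).eq, ← mul_assoc,
          Unitary.star_mul_self_of_mem (h.unitary m), one_mul]
      calc _ = Star.star (partialProduct u m) * (Star.star (u m) * w * u m)
              * partialProduct u m := by simp only [mul_assoc]
        _ = _ := by rw [hc]
  obtain ⟨J', hJ'⟩ := h.star.exists_mem_conj n₀ hw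
  rw [h.partialProduct_star, star_star] at hJ'
  obtain ⟨m, hm, hmn⟩ := ((hconj J' _ hJ').and (Filter.eventually_ge_atTop n₀)).exists
  have hinv : α⁻¹ w = Star.star (partialProduct u n₀) * w * partialProduct u n₀ := by
    apply EquivLike.injective α
    rw [hm, ← hstab m hmn]
    have hU := Unitary.mul_star_self_of_mem (h.partialProduct_mem_unitary m)
    have e : α (α⁻¹ w) = w := α.apply_symm_apply w
    rw [e]
    calc w = (partialProduct u m * Star.star (partialProduct u m)) * w
              * (partialProduct u m * Star.star (partialProduct u m)) := by rw [hU]; simp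
      _ = _ := by simp only [mul_assoc]
  filter_upwards [Filter.eventually_ge_atTop n₀] with n hn
  rw [hinv, h.partialProduct_star, star_star, hstab n hn]

variable (S)

/-- The group of finite depth quantum circuits. -/
def FDQC : Subgroup S.QCA where
  carrier := {α | S.IsFiniteDepthCircuit α}
  one_mem' := ⟨[], by simp, rfl⟩
  mul_mem' := by
    rintro α β ⟨L, hL, hα⟩ ⟨L', hL', hβ⟩
    refine ⟨L ++ L', fun γ hγ => ?_, by simp [hα, hβ]⟩
    rcases List.mem_append.mp hγ with h | h
    · exact hL γ h
    · exact hL' γ h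
  inv_mem' := by
    rintro α ⟨L, hL, hα⟩
    refine ⟨(L.map fun γ => γ⁻¹).reverse, fun γ hγ => ?_, ?_⟩
    · simp only [List.mem_reverse, List.mem_map] at hγ
      obtain ⟨δ, hδ, rfl⟩ := hγ
      exact (hL δ hδ).inv
    · rw [← List.prod_inv_reverse, hα]; rfl

end Circuits

/-! ### The finite index property -/

section Index

variable {A : Type*} [CStarAlgebra A] [PartialOrder A] [StarOrderedRing A] (S : SpinChain A)
  (τ : A →ₚ[ℂ] ℂ)

/-- The left-infinite von Neumann algebra `𝒜 x`, generated on `L²(A, τ)` by the algebras of all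
intervals contained in `(-∞, x]`. -/
def leftAlgebra (x : ℤ) : VonNeumannAlgebra τ.GNS :=
  vonNeumannGenerated (⋃ (I : NonemptyInterval ℤ) (_ : I.snd ≤ x),
    τ.gnsStarAlgHom '' (S.alg I : Set A))

/-- The image `α (𝒜 x)` under the extension of `α` to `A''`. -/
def imageLeftAlgebra (hτ : IsUniqueTracialState τ) (α : A ≃⋆ₐ[ℂ] A) (x : ℤ) :
    VonNeumannAlgebra τ.GNS :=
  vonNeumannMap (extend τ hτ α) (S.leftAlgebra τ x)

/-- The (left) finite index property. -/
structure FiniteIndexProperty : Prop where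
  isFactor : ∀ x, IsFactor (S.leftAlgebra τ x)
  infiniteDimensional : ∀ x, ¬ FiniteDimensional ℂ (S.leftAlgebra τ x).toStarSubalgebra
  finite_index : ∀ x z, x < z →
    jonesIndex (gnsVector τ) (S.leftAlgebra τ z) (S.leftAlgebra τ x) < ⊤

/-- `([α (𝒜 x) : 𝒜 y] / [𝒜 x : 𝒜 y]) ^ (1 / 2)`. -/
def indexRatio (hτ : IsUniqueTracialState τ) (α : A ≃⋆ₐ[ℂ] A) (x y : ℤ) : ℝ :=
  Real.sqrt
    ((jonesIndex (gnsVector τ) (S.imageLeftAlgebra τ hτ α x) (S.leftAlgebra τ y)).toReal /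
      (jonesIndex (gnsVector τ) (S.leftAlgebra τ x) (S.leftAlgebra τ y)).toReal)

end Index

end SpinChain

end QCAIndex

end

/-! The index is computed with Parseval frames. An `N`-linear isometry of `K` into `L²(N) ⊗ ℓ²(ℕ)`
is the same as a sequence of `N`-linear coefficient maps `C i : K → L²(N)` with `∑ ‖C i x‖² = ‖x‖²`,
and its dimension sum becomes `∑ ‖(C i)* Ω‖²`. Two frames `C`, `B` give the same sum: expand it as
`∑ ‖B j (C i)* Ω‖²` and pass to adjoints, which preserves the norm at `Ω` because `Ω` is also
tracial for the commutant of `N` on `L²(N)` (`trace_of_commute`, `IsModuleFrame.dim_eq`).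

Multiplicativity of the index (`jonesIndex_mul`) composes a frame of `L²(M)` over `P` with a frame
`B` of `L²(P)` over `N`. The functional `T ↦ ∑ ⟨(B j)* Ω, T (B j)* Ω⟩` is a normal trace on the
commutant of `P` on `L²(P)`. That commutant is a factor, so the functional is a multiple of the
vector trace of `Ω` (`IsTraceVector.trace_eq_zero`), and the double sum factors.

For a QCA of spread `l` one has `𝒜_{x-l} ⊆ α(𝒜_x) ⊆ 𝒜_{x+l}`, so monotonicity of the index gives
finiteness. The unitary of `α` fixes the trace vector and hence preserves indices, so the tower
`αβ(𝒜_x) ⊇ α(𝒜_z) ⊇ 𝒜_y` makes the ratio multiplicative (`SpinChain.indexRatio_mul`). Independence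
of `x` and `y` is the special case in which one factor is the identity. A depth one circuit maps
some `𝒜_x` into itself, so its index is at most `1`; so does its inverse, and the index is `1`. -/

noncomputable section

namespace QCAIndex

open Filter Topology

/-! ### Trace vectors and the commutant on `L²(M)` -/

section TraceVectors

variable {H : Type*} [NormedAddCommGroup H] [InnerProductSpace ℂ H] [CompleteSpace H]

theorem inner_star_left (T : H →L[ℂ] H) (x y : H) : ⟪star T x, y⟫_ℂ = ⟪x, T y⟫_ℂ := by
  rw [ContinuousLinearMap.star_eq_adjoint, ContinuousLinearMap.adjoint_inner_left]

theorem inner_star_right (T : H →L[ℂ] H) (x y : H) : ⟪x, star T y⟫_ℂ = ⟪T x, y⟫_ℂ := by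
  rw [ContinuousLinearMap.star_eq_adjoint, ContinuousLinearMap.adjoint_inner_right]

theorem norm_sq_apply_eq (T : H →L[ℂ] H) (x : H) :
    ((‖T x‖ ^ 2 : ℝ) : ℂ) = ⟪x, (star T * T) x⟫_ℂ := by
  rw [mul_apply_eq_comp, inner_star_right, inner_self_eq_norm_sq_to_K]
  simp

theorem norm_star_apply_eq_of_trace {a : H →L[ℂ] H} {Ω : H}
    (h : ⟪Ω, (star a * a) Ω⟫_ℂ = ⟪Ω, (a * star a) Ω⟫_ℂ) : ‖star a Ω‖ = ‖a Ω‖ := by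
  have h1 := norm_sq_apply_eq a Ω
  have h2 := norm_sq_apply_eq (star a) Ω
  rw [star_star, ← h, ← h1] at h2
  exact (sq_eq_sq₀ (norm_nonneg _) (norm_nonneg _)).1 (by exact_mod_cast h2)

/-- If `Ω` is tracial for `D` and `T` commutes with `D`, approximations of `T Ω` by `d Ω` with
`d ∈ D` approximate `T* Ω` by `d* Ω`. -/
theorem exists_seq_tendsto_of_commute (D : StarSubalgebra ℂ (H →L[ℂ] H)) {Ω : H}
    (htr : ∀ a ∈ D, ∀ b ∈ D, ⟪Ω, (a * b) Ω⟫_ℂ = ⟪Ω, (b * a) Ω⟫_ℂ) {T : H →L[ℂ] H}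
    (hT : ∀ d ∈ D, d * T = T * d) (h₁ : T Ω ∈ closure ((fun d : H →L[ℂ] H => d Ω) '' D))
    (h₂ : star T Ω ∈ closure ((fun d : H →L[ℂ] H => d Ω) '' D)) :
    ∃ d : ℕ → H →L[ℂ] H, (∀ n, d n ∈ D) ∧ Tendsto (fun n => d n Ω) atTop (𝓝 (T Ω)) ∧
      Tendsto (fun n => star (d n) Ω) atTop (𝓝 (star T Ω)) := by
  obtain ⟨x, hx, hlim⟩ := mem_closure_iff_seq_limit.1 h₁
  choose d hd hdx using hx
  have hdx' : x = fun n => d n Ω := funext fun n => (hdx n).symm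
  subst hdx'
  refine ⟨d, hd, hlim, ?_⟩
  have hstar : ∀ a ∈ D, ‖star a Ω‖ = ‖a Ω‖ := fun a ha =>
    norm_star_apply_eq_of_trace (htr _ (star_mem ha) _ ha)
  -- By the trace property `d Ω ↦ d* Ω` is isometric on `D Ω`, so it carries Cauchy sequences to
  -- Cauchy sequences.
  have hcau : CauchySeq (fun n => star (d n) Ω) := by
    have h := hlim.cauchySeq
    rw [Metric.cauchySeq_iff] at h ⊢
    intro ε hε
    obtain ⟨N, hN⟩ := h ε hε
    refine ⟨N, fun m hm n hn => ?_⟩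
    have h3 := hstar _ (sub_mem (hd m) (hd n))
    rw [star_sub, sub_apply, sub_apply] at h3
    rw [dist_eq_norm, h3, ← dist_eq_norm]
    exact hN m hm n hn
  obtain ⟨ζ, hζ⟩ := cauchySeq_tendsto_of_complete hcau
  have hζmem : ζ ∈ closure ((fun d : H →L[ℂ] H => d Ω) '' (D : Set (H →L[ℂ] H))) :=
    mem_closure_of_tendsto hζ (Eventually.of_forall fun n => ⟨star (d n), star_mem (hd n), rfl⟩)
  -- Both `ζ` and `T* Ω` pair with `b Ω` to `⟨b* Ω, T Ω⟩`: the first by the trace property in the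
  -- limit, the second because `T` commutes with `b`.
  have hperp : ∀ b ∈ D, ⟪star T Ω - ζ, b Ω⟫_ℂ = 0 := by
    intro b hb
    have l1 : Tendsto (fun n => ⟪star (d n) Ω, b Ω⟫_ℂ) atTop (𝓝 ⟪ζ, b Ω⟫_ℂ) :=
      hζ.inner tendsto_const_nhds
    have l2 : Tendsto (fun n => ⟪star b Ω, d n Ω⟫_ℂ) atTop (𝓝 ⟪star b Ω, T Ω⟫_ℂ) :=
      tendsto_const_nhds.inner hlim
    have e : (fun n => ⟪star (d n) Ω, b Ω⟫_ℂ) = fun n => ⟪star b Ω, d n Ω⟫_ℂ := by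
      ext n
      rw [inner_star_left, inner_star_left]
      exact htr _ (hd n) _ hb
    rw [e] at l1
    rw [inner_sub_left, tendsto_nhds_unique l1 l2, inner_star_left, inner_star_left, sub_eq_zero]
    exact congrArg (fun S : H →L[ℂ] H => ⟪Ω, S Ω⟫_ℂ) (hT b hb).symm
  have hcl : closure ((fun d : H →L[ℂ] H => d Ω) '' (D : Set (H →L[ℂ] H)))
      ⊆ {y | ⟪star T Ω - ζ, y⟫_ℂ = 0} :=
    closure_minimal (by rintro _ ⟨b, hb, rfl⟩; exact hperp b hb)
      (isClosed_eq (by fun_prop) (by fun_prop))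
  -- `T* Ω - ζ` lies in the closure of `D Ω` and is orthogonal to it.
  have hzero : ⟪star T Ω - ζ, star T Ω - ζ⟫_ℂ = 0 := by
    rw [inner_sub_right, hcl h₂, hcl hζmem, sub_zero]
  rwa [sub_eq_zero.1 (inner_self_eq_zero.1 hzero)]

/-- A tracial vector for `D` is tracial for the operators that commute with `D` and map it into
the closure of `D Ω`. -/
theorem trace_of_commute (D : StarSubalgebra ℂ (H →L[ℂ] H)) {Ω : H}
    (htr : ∀ a ∈ D, ∀ b ∈ D, ⟪Ω, (a * b) Ω⟫_ℂ = ⟪Ω, (b * a) Ω⟫_ℂ) {S T : H →L[ℂ] H}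
    (hS : ∀ d ∈ D, d * S = S * d) (hT : ∀ d ∈ D, d * T = T * d)
    (hS₁ : S Ω ∈ closure ((fun d : H →L[ℂ] H => d Ω) '' D))
    (hS₂ : star S Ω ∈ closure ((fun d : H →L[ℂ] H => d Ω) '' D))
    (hT₁ : T Ω ∈ closure ((fun d : H →L[ℂ] H => d Ω) '' D))
    (hT₂ : star T Ω ∈ closure ((fun d : H →L[ℂ] H => d Ω) '' D)) :
    ⟪Ω, (S * T) Ω⟫_ℂ = ⟪Ω, (T * S) Ω⟫_ℂ := by
  obtain ⟨s, hs, hs1, hs2⟩ := exists_seq_tendsto_of_commute D htr hS hS₁ hS₂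
  obtain ⟨t, ht, ht1, ht2⟩ := exists_seq_tendsto_of_commute D htr hT hT₁ hT₂
  have l1 := hs2.inner (𝕜 := ℂ) ht1
  have l2 := ht2.inner (𝕜 := ℂ) hs1
  have e : (fun n => ⟪star (s n) Ω, t n Ω⟫_ℂ) = fun n => ⟪star (t n) Ω, s n Ω⟫_ℂ := by
    ext n
    rw [inner_star_left, inner_star_left]
    exact htr _ (hs n) _ (ht n)
  rw [e] at l1
  have := tendsto_nhds_unique l1 l2
  rwa [inner_star_left, inner_star_left] at this

/-- `Ω` is a unit vector that is tracial for `M` and cyclic for the commutant of `M`. -/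
structure IsTraceVector (M : VonNeumannAlgebra H) (Ω : H) : Prop where
  norm_eq_one : ‖Ω‖ = 1
  trace : ∀ a ∈ M, ∀ b ∈ M, ⟪Ω, (a * b) Ω⟫_ℂ = ⟪Ω, (b * a) Ω⟫_ℂ
  dense : Dense ((fun d : H →L[ℂ] H => d Ω) '' (M.commutant : Set (H →L[ℂ] H)))

theorem commutant_le_commutant {M N : VonNeumannAlgebra H} (h : N ≤ M) :
    M.commutant ≤ N.commutant := fun T hT => by
  rw [VonNeumannAlgebra.mem_commutant_iff] at hT ⊢
  exact fun g hg => hT g (h hg)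

/-- Passing to a subalgebra enlarges the commutant, so cyclicity survives. All algebras of the
theorem get their trace vector in this way from `A''`. -/
theorem IsTraceVector.mono {M N : VonNeumannAlgebra H} {Ω : H} (h : IsTraceVector M Ω)
    (hle : N ≤ M) : IsTraceVector N Ω where
  norm_eq_one := h.norm_eq_one
  trace a ha b hb := h.trace a (hle ha) b (hle hb)
  dense := h.dense.mono (Set.image_mono (commutant_le_commutant hle))

theorem mem_L2_iff {M : VonNeumannAlgebra H} {Ω x : H} :
    x ∈ L2 M Ω ↔ x ∈ closure ((fun d : H →L[ℂ] H => d Ω) '' (M : Set (H →L[ℂ] H))) := Iff.rfl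

theorem apply_mem_L2 {M : VonNeumannAlgebra H} (Ω : H) {a : H →L[ℂ] H} (ha : a ∈ M) :
    a Ω ∈ L2 M Ω := mem_L2_iff.2 (subset_closure ⟨a, ha, rfl⟩)

theorem L2_mono {M N : VonNeumannAlgebra H} (h : N ≤ M) (Ω : H) : L2 N Ω ≤ L2 M Ω :=
  fun _ hx => closure_mono (Set.image_mono h) hx

theorem L2_invariant {M : VonNeumannAlgebra H} {Ω : H} {a : H →L[ℂ] H} (ha : a ∈ M) {x : H}
    (hx : x ∈ L2 M Ω) : a x ∈ L2 M Ω := by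
  have : closure ((fun d : H →L[ℂ] H => d Ω) '' (M : Set (H →L[ℂ] H)))
      ⊆ {y | a y ∈ L2 M Ω} := by
    refine closure_minimal ?_ (isClosed_closure.preimage a.continuous)
    rintro _ ⟨b, hb, rfl⟩
    exact apply_mem_L2 Ω (mul_mem ha hb)
  exact this hx

theorem starProjection_mem_commutant {M : VonNeumannAlgebra H} {K : Submodule ℂ H}
    [K.HasOrthogonalProjection] (hK : ∀ a ∈ M, ∀ x ∈ K, a x ∈ K) :
    K.starProjection ∈ M.commutant := by
  rw [VonNeumannAlgebra.IsStarProjection.mem_iff isStarProjection_starProjection]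
  intro y hy
  rw [VonNeumannAlgebra.commutant_commutant] at hy
  rw [Module.End.mem_invtSubmodule]
  intro x hx
  simp only [Submodule.range_starProjection] at hx ⊢
  exact hK y hy x hx

/-- The projection onto `L²(M)`. -/
abbrev L2proj (M : VonNeumannAlgebra H) (Ω : H) : H →L[ℂ] H := (L2 M Ω).starProjection

theorem L2proj_mem_commutant (M : VonNeumannAlgebra H) (Ω : H) : L2proj M Ω ∈ M.commutant :=
  starProjection_mem_commutant fun _ ha _ hx => L2_invariant ha hx

theorem star_starProjection (K : Submodule ℂ H) [K.HasOrthogonalProjection] :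
    star K.starProjection = K.starProjection := isSelfAdjoint_starProjection K

theorem L2proj_mul_self (M : VonNeumannAlgebra H) (Ω : H) :
    L2proj M Ω * L2proj M Ω = L2proj M Ω := isStarProjection_starProjection.isIdempotentElem

theorem L2proj_apply_of_mem {M : VonNeumannAlgebra H} {Ω x : H} (hx : x ∈ L2 M Ω) :
    L2proj M Ω x = x := Submodule.starProjection_eq_self_iff.2 hx

theorem L2proj_apply_mem (M : VonNeumannAlgebra H) (Ω x : H) : L2proj M Ω x ∈ L2 M Ω :=
  Submodule.starProjection_apply_mem _ _

/-- The commutant of `M` on `L²(M)`, as operators on `H` that vanish on the complement. -/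
def corner (M : VonNeumannAlgebra H) (Ω : H) : NonUnitalStarSubalgebra ℂ (H →L[ℂ] H) where
  carrier := {S | S ∈ M.commutant ∧ L2proj M Ω * S = S ∧ S * L2proj M Ω = S}
  add_mem' := by
    rintro a b ⟨h1, h2, h3⟩ ⟨h4, h5, h6⟩
    exact ⟨add_mem h1 h4, by rw [mul_add, h2, h5], by rw [add_mul, h3, h6]⟩
  zero_mem' := ⟨zero_mem _, by simp, by simp⟩
  mul_mem' := by
    rintro a b ⟨h1, h2, h3⟩ ⟨h4, h5, h6⟩
    exact ⟨mul_mem h1 h4, by rw [← mul_assoc, h2], by rw [mul_assoc, h6]⟩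
  smul_mem' := by
    rintro c a ⟨h1, h2, h3⟩
    exact ⟨M.commutant.toStarSubalgebra.smul_mem h1 c, by rw [mul_smul_comm, h2],
      by rw [smul_mul_assoc, h3]⟩
  star_mem' := by
    rintro a ⟨h1, h2, h3⟩
    refine ⟨star_mem h1, ?_, ?_⟩
    · conv_rhs => rw [← h3, star_mul, star_starProjection]
    · conv_rhs => rw [← h2, star_mul, star_starProjection]

theorem L2proj_mem_corner (M : VonNeumannAlgebra H) (Ω : H) : L2proj M Ω ∈ corner M Ω :=
  ⟨L2proj_mem_commutant M Ω, L2proj_mul_self M Ω, L2proj_mul_self M Ω⟩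

theorem compress_mem_corner {M : VonNeumannAlgebra H} (Ω : H) {S : H →L[ℂ] H}
    (hS : S ∈ M.commutant) : L2proj M Ω * S * L2proj M Ω ∈ corner M Ω :=
  ⟨mul_mem (mul_mem (L2proj_mem_commutant M Ω) hS) (L2proj_mem_commutant M Ω),
    by rw [← mul_assoc, ← mul_assoc, L2proj_mul_self], by rw [mul_assoc, L2proj_mul_self]⟩

variable {M : VonNeumannAlgebra H} {Ω : H}

theorem corner_apply_mem {S : H →L[ℂ] H} (hS : S ∈ corner M Ω) (x : H) : S x ∈ L2 M Ω := by
  rw [← hS.2.1]; exact L2proj_apply_mem M Ω _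

theorem commute_apply {S a : H →L[ℂ] H} (hS : S ∈ M.commutant) (ha : a ∈ M) (x : H) :
    S (a x) = a (S x) :=
  congrArg (fun T : H →L[ℂ] H => T x) (VonNeumannAlgebra.mem_commutant_iff.1 hS a ha).symm

/-- `S` commutes with `M` and lives on `L²(M)`, the closure of `M Ω`, so its value at `Ω` determines
it. -/
theorem corner_ext {S T : H →L[ℂ] H} (hS : S ∈ corner M Ω) (hT : T ∈ corner M Ω)
    (h : S Ω = T Ω) : S = T := by
  have key : closure ((fun d : H →L[ℂ] H => d Ω) '' (M : Set (H →L[ℂ] H))) ⊆ {x | S x = T x} := by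
    refine closure_minimal ?_ (isClosed_eq S.continuous T.continuous)
    rintro _ ⟨a, ha, rfl⟩
    change S (a Ω) = T (a Ω)
    rw [commute_apply hS.1 ha, commute_apply hT.1 ha, h]
  ext x
  rw [← hS.2.2, ← hT.2.2]
  exact key (L2proj_apply_mem M Ω x)

/-- `T ↦ ⟨Ω, T Ω⟩` is a trace on the commutant of `M`, as long as everything stays in `L²(M)`. -/
theorem IsTraceVector.norm_star_apply (h : IsTraceVector M Ω) {T : H →L[ℂ] H}
    (hT : T ∈ M.commutant) (h₁ : T Ω ∈ L2 M Ω) (h₂ : star T Ω ∈ L2 M Ω) :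
    ‖star T Ω‖ = ‖T Ω‖ := by
  refine norm_star_apply_eq_of_trace ?_
  refine trace_of_commute M.toStarSubalgebra h.trace
    (VonNeumannAlgebra.mem_commutant_iff.1 (star_mem hT)) (VonNeumannAlgebra.mem_commutant_iff.1 hT)
    h₂ ?_ h₁ h₂
  rw [star_star]; exact h₁

theorem IsTraceVector.norm_star_apply_of_mem_corner (h : IsTraceVector M Ω) {T : H →L[ℂ] H}
    (hT : T ∈ corner M Ω) : ‖star T Ω‖ = ‖T Ω‖ :=
  h.norm_star_apply hT.1 (corner_apply_mem hT _) (corner_apply_mem (star_mem hT) _)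

/-- `Ω` is cyclic for the corner in `L²(M)`. -/
theorem IsTraceVector.L2_subset_closure_corner (h : IsTraceVector M Ω) :
    (L2 M Ω : Set H) ⊆ closure ((fun d : H →L[ℂ] H => d Ω) '' (corner M Ω : Set (H →L[ℂ] H))) := by
  intro x hx
  have hx' := h.dense x
  have := image_closure_subset_closure_image (L2proj M Ω).continuous ⟨x, hx', rfl⟩
  rw [L2proj_apply_of_mem hx, Set.image_image] at this
  refine closure_mono ?_ this
  rintro _ ⟨y, hy, rfl⟩
  refine ⟨_, compress_mem_corner Ω hy, ?_⟩
  simp only [mul_apply_eq_comp]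
  rw [L2proj_apply_of_mem (trace_vector_mem_L2 M Ω)]

theorem IsTraceVector.separating (h : IsTraceVector M Ω) {a : H →L[ℂ] H} (ha : a ∈ M)
    (h0 : a Ω = 0) : a = 0 := by
  have key : closure ((fun d : H →L[ℂ] H => d Ω) '' (M.commutant : Set (H →L[ℂ] H)))
      ⊆ {x | a x = 0} := by
    refine closure_minimal ?_ (isClosed_eq a.continuous continuous_const)
    rintro _ ⟨y, hy, rfl⟩
    change a (y Ω) = 0
    rw [← commute_apply hy ha, h0, map_zero]
  ext x
  exact key (h.dense x)

/-- If `M` is a factor, then so is its commutant on `L²(M)`. -/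
theorem IsTraceVector.corner_center (h : IsTraceVector M Ω) (hM : IsFactor M)
    {X : H →L[ℂ] H} (hX : X ∈ corner M Ω) (hcomm : ∀ S ∈ corner M Ω, Commute X S) :
    ∃ c : ℂ, X = c • L2proj M Ω := by
  have hΩ := L2proj_apply_of_mem (trace_vector_mem_L2 M Ω)
  -- This bound makes `y Ω ↦ y (X Ω)` well defined and bounded. On `L²(M)` the operator `y` has the
  -- same norms as the square root of its compression `e y* y e`, where `e` projects onto `L²(M)`,
  -- and this square root commutes with `X`.
  have hbound : ∀ y ∈ M.commutant, ‖y (X Ω)‖ ≤ ‖X‖ * ‖y Ω‖ := by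
    intro y hy
    set b : H →L[ℂ] H := star (y * L2proj M Ω) * (y * L2proj M Ω) with hb
    have hbmem : b ∈ corner M Ω := by
      have := compress_mem_corner (M := M) Ω (mul_mem (star_mem hy) hy)
      rwa [hb, star_mul, star_starProjection, mul_assoc, ← mul_assoc (star y), ← mul_assoc]
    have hbnn : 0 ≤ b := star_mul_self_nonneg _
    have hc : Commute (CFC.sqrt b) X := by
      have := ((hcomm b hbmem).symm).cfc_nnreal NNReal.sqrt
      rwa [← CFC.sqrt_eq_cfc] at this
    have hsq : star (CFC.sqrt b) * CFC.sqrt b = b := by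
      rw [(CFC.sqrt_nonneg b).isSelfAdjoint.star_eq, CFC.sqrt_mul_sqrt_self b hbnn]
    have hnorm : ∀ x ∈ L2 M Ω, ‖y x‖ = ‖CFC.sqrt b x‖ := by
      intro x hx
      have h1 := norm_sq_apply_eq (y * L2proj M Ω) x
      have h2 := norm_sq_apply_eq (CFC.sqrt b) x
      rw [hsq, hb, ← h1, mul_apply_eq_comp, L2proj_apply_of_mem hx] at h2
      exact ((sq_eq_sq₀ (norm_nonneg _) (norm_nonneg _)).1 (by exact_mod_cast h2)).symm
    rw [hnorm _ (corner_apply_mem hX Ω), hnorm _ (trace_vector_mem_L2 M Ω)]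
    calc ‖CFC.sqrt b (X Ω)‖ = ‖X (CFC.sqrt b Ω)‖ :=
          congrArg (fun T : H →L[ℂ] H => ‖T Ω‖) hc.eq
      _ ≤ _ := X.le_opNorm _
  let f : M.commutant.toStarSubalgebra →ₗ[ℂ] H :=
    (ContinuousLinearMap.apply ℂ H (X Ω) : (H →L[ℂ] H) →L[ℂ] H).toLinearMap ∘ₗ
      (Subalgebra.toSubmodule M.commutant.toStarSubalgebra.toSubalgebra).subtype
  let e : M.commutant.toStarSubalgebra →ₗ[ℂ] H :=
    (ContinuousLinearMap.apply ℂ H Ω : (H →L[ℂ] H) →L[ℂ] H).toLinearMap ∘ₗ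
      (Subalgebra.toSubmodule M.commutant.toStarSubalgebra.toSubalgebra).subtype
  have hdense : DenseRange e := by
    refine h.dense.mono ?_
    rintro _ ⟨y, hy, rfl⟩
    exact ⟨⟨y, hy⟩, rfl⟩
  set x : H →L[ℂ] H := f.extendOfNorm e
  have hx : ∀ y ∈ M.commutant, x (y Ω) = y (X Ω) := fun y hy =>
    LinearMap.extendOfNorm_eq hdense ⟨‖X‖, fun z => hbound z.1 z.2⟩ ⟨y, hy⟩
  -- By construction `x` commutes with left multiplication by `M'` on the dense set `M' Ω`.
  have hxM : x ∈ M := by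
    rw [← M.commutant_commutant, VonNeumannAlgebra.mem_commutant_iff]
    intro y hy
    have key : closure ((fun d : H →L[ℂ] H => d Ω) '' (M.commutant : Set (H →L[ℂ] H)))
        ⊆ {v | (y * x) v = (x * y) v} := by
      refine closure_minimal ?_ (isClosed_eq (y * x).continuous (x * y).continuous)
      rintro _ ⟨z, hz, rfl⟩
      change y (x (z Ω)) = x ((y * z) Ω)
      rw [hx z hz, hx _ (mul_mem hy hz)]; rfl
    ext v
    exact key (h.dense v)
  -- On vectors `z Ω` with `z` in the corner, `x (z Ω) = z (X Ω) = X (z Ω)` because `X` is central.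
  have hxX : ∀ v ∈ L2 M Ω, x v = X v := by
    have key : closure ((fun d : H →L[ℂ] H => d Ω) '' (corner M Ω : Set (H →L[ℂ] H)))
        ⊆ {v | x v = X v} := by
      refine closure_minimal ?_ (isClosed_eq x.continuous X.continuous)
      rintro _ ⟨z, hz, rfl⟩
      change x (z Ω) = X (z Ω)
      rw [hx z hz.1]
      exact congrArg (fun T : H →L[ℂ] H => T Ω) (hcomm z hz).eq.symm
    exact fun v hv => key (h.L2_subset_closure_corner hv)
  -- `Ω` separates `M`, so the commutators of `x` with `M` need only be tested at `Ω`, where `x` may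
  -- be replaced by `X`.
  have hxM' : x ∈ M.commutant := by
    rw [VonNeumannAlgebra.mem_commutant_iff]
    intro a ha
    refine sub_eq_zero.1 (h.separating (sub_mem (mul_mem ha hxM) (mul_mem hxM ha)) ?_)
    change a (x Ω) - x (a Ω) = 0
    rw [hxX _ (apply_mem_L2 Ω ha), hxX _ (trace_vector_mem_L2 M Ω), commute_apply hX.1 ha, sub_self]
  obtain ⟨c, hc⟩ := hM x hxM hxM'
  refine ⟨c, corner_ext hX (SMulMemClass.smul_mem c (L2proj_mem_corner M Ω)) ?_⟩
  rw [← hxX _ (trace_vector_mem_L2 M Ω), hc]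
  simp only [smul_apply, one_apply_eq_self]
  rw [hΩ]

end TraceVectors

/-! ### Uniqueness of the normal trace on the commutant of a factor -/

section TraceUniqueness

variable {H : Type*} [NormedAddCommGroup H] [InnerProductSpace ℂ H] [CompleteSpace H]
  {M : VonNeumannAlgebra H} {Ω : H}

/-- Bounded sequences in the corner that converge at `Ω` converge strongly in the corner. -/
theorem exists_strong_limit_of_corner {T : ℕ → H →L[ℂ] H} {r : ℝ} {ξ : H}
    (hT : ∀ n, T n ∈ corner M Ω) (hr : ∀ n, ‖T n‖ ≤ r)
    (hξ : Tendsto (fun n => T n Ω) atTop (𝓝 ξ)) :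
    ∃ S ∈ corner M Ω, ‖S‖ ≤ r ∧ ∀ x, Tendsto (fun n => T n x) atTop (𝓝 (S x)) := by
  have hr0 : 0 ≤ r := (norm_nonneg _).trans (hr 0)
  have hcau : ∀ x, CauchySeq (fun n => T n x) := by
    intro x
    rw [Metric.cauchySeq_iff']
    intro ε hε
    have hx := L2proj_apply_mem M Ω x
    -- `T n` sees only the projection of `x` to `L²(M)`, which is close to some `a Ω`, and `T n (a
    -- Ω) = a (T n Ω)` converges. The `+ 1` covers `r = 0`.
    obtain ⟨_, ⟨a, ha, rfl⟩, hax⟩ := Metric.mem_closure_iff.1 (mem_L2_iff.1 hx)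
      (ε / (4 * (r + 1))) (by positivity)
    have hlim : CauchySeq (fun n => a (T n Ω)) :=
      ((a.continuous.tendsto ξ).comp hξ).cauchySeq
    obtain ⟨N, hN⟩ := Metric.cauchySeq_iff'.1 hlim (ε / 2) (by positivity)
    refine ⟨N, fun n hn => ?_⟩
    have happ : ∀ n, dist (T n x) (a (T n Ω)) ≤ ε / 4 := by
      intro n
      rw [← commute_apply (hT n).1 ha, ← (hT n).2.2, mul_apply_eq_comp, (hT n).2.2, dist_eq_norm,
        ← map_sub]
      refine ((T n).le_opNorm _).trans ?_
      rw [← dist_eq_norm]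
      calc ‖T n‖ * dist (L2proj M Ω x) (a Ω) ≤ (r + 1) * (ε / (4 * (r + 1))) := by
            gcongr
            exact (hr n).trans (by linarith)
        _ = ε / 4 := by field_simp
    calc dist (T n x) (T N x) ≤ dist (T n x) (a (T n Ω)) + dist (a (T n Ω)) (a (T N Ω))
          + dist (a (T N Ω)) (T N x) := dist_triangle4 _ _ _ _
      _ < ε / 4 + ε / 2 + ε / 4 := by
        have h1 := happ n
        have h2 := happ N
        rw [dist_comm] at h2
        have h3 := hN n hn
        linarith
      _ = ε := by ring
  choose f hf using fun x => cauchySeq_tendsto_of_complete (hcau x)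
  let S : H →L[ℂ] H := continuousLinearMapOfTendsto T (tendsto_pi_nhds.2 hf)
  have hS : ∀ x, Tendsto (fun n => T n x) atTop (𝓝 (S x)) := hf
  refine ⟨S, ⟨?_, ?_, ?_⟩, ?_, hS⟩
  · rw [VonNeumannAlgebra.mem_commutant_iff]
    intro a ha
    ext x
    refine tendsto_nhds_unique ((a.continuous.tendsto _).comp (hS x)) ?_
    refine (hS (a x)).congr fun n => ?_
    exact commute_apply (hT n).1 ha x
  · ext x
    refine tendsto_nhds_unique (((L2proj M Ω).continuous.tendsto _).comp (hS x)) ?_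
    refine (hS x).congr fun n => ?_
    exact congrArg (fun R : H →L[ℂ] H => R x) (hT n).2.1.symm
  · ext x
    refine tendsto_nhds_unique (hS (L2proj M Ω x)) ?_
    refine (hS x).congr fun n => ?_
    exact congrArg (fun R : H →L[ℂ] H => R x) (hT n).2.2.symm
  · refine S.opNorm_le_bound hr0 fun x => le_of_tendsto (hS x).norm (Eventually.of_forall fun n => ?_)
    exact ((T n).le_opNorm x).trans (by gcongr; exact hr n)

/-- Polarization, with the projection `e` onto `L²(M)` as the unit of the corner. -/
theorem corner_linearMap_ext {f g : (H →L[ℂ] H) →ₗ[ℂ] ℂ}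
    (h : ∀ S ∈ corner M Ω, f (star S * S) = g (star S * S)) {T : H →L[ℂ] H}
    (hT : T ∈ corner M Ω) : f T = g T := by
  set e := L2proj M Ω with he
  have hee : e * e = e := L2proj_mul_self M Ω
  have hse : star e = e := star_starProjection _
  have hemem : e ∈ corner M Ω := L2proj_mem_corner M Ω
  have h2 : T * e = T := hT.2.2
  have h3 : e * star T = star T := (star_mem hT).2.1
  have key : (4 : ℂ) • T = star (e + star T) * (e + star T)
      + Complex.I • (star (e + Complex.I • star T) * (e + Complex.I • star T))
      - star (e - star T) * (e - star T)
      - Complex.I • (star (e - Complex.I • star T) * (e - Complex.I • star T)) := by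
    simp only [star_add, star_sub, star_smul, star_star, hse, add_mul, mul_add, sub_mul, mul_sub,
      smul_mul_assoc, mul_smul_comm, hee, h2, h3, smul_add, smul_sub, smul_smul]
    simp only [Complex.star_def, Complex.conj_I, neg_smul, mul_neg, Complex.I_mul_I,
      neg_neg, one_smul, mul_one]
    module
  have hst := star_mem hT
  have hI : Complex.I • star T ∈ corner M Ω := SMulMemClass.smul_mem _ hst
  have h5 : f ((4 : ℂ) • T) = g ((4 : ℂ) • T) := by
    rw [key]
    simp only [map_add, map_sub, map_smul]
    rw [h _ (add_mem hemem hst), h _ (add_mem hemem hI), h _ (sub_mem hemem hst),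
      h _ (sub_mem hemem hI)]
  rw [map_smul, map_smul] at h5
  exact smul_right_injective ℂ (by norm_num : (4 : ℂ) ≠ 0) h5

theorem conj_mem_corner {u T : H →L[ℂ] H} (hu : u ∈ M.commutant) (hue : Commute u (L2proj M Ω))
    (hT : T ∈ corner M Ω) : u * T * star u ∈ corner M Ω := by
  have hue' : L2proj M Ω * star u = star u * L2proj M Ω := by
    have := congrArg star hue.eq
    rwa [star_mul, star_mul, star_starProjection] at this
  refine ⟨mul_mem (mul_mem hu hT.1) (star_mem hu), ?_, ?_⟩
  · rw [← mul_assoc, ← mul_assoc, ← hue.eq, mul_assoc u, hT.2.1]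
  · rw [mul_assoc, ← hue', mul_assoc u, ← mul_assoc T, hT.2.2, ← mul_assoc]

theorem mul_star_mem_corner {u T : H →L[ℂ] H} (hu : u ∈ M.commutant)
    (hue : Commute u (L2proj M Ω)) (hT : T ∈ corner M Ω) : T * star u ∈ corner M Ω := by
  have hue' : L2proj M Ω * star u = star u * L2proj M Ω := by
    have := congrArg star hue.eq
    rwa [star_mul, star_mul, star_starProjection] at this
  exact ⟨mul_mem hT.1 (star_mem hu), by rw [← mul_assoc, hT.2.1],
    by rw [mul_assoc, ← hue', ← mul_assoc, hT.2.2]⟩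

/-- A trace on the corner is invariant under conjugation by unitaries. -/
theorem trace_conj_corner {ω : (H →L[ℂ] H) →ₗ[ℂ] ℂ}
    (hω : ∀ S ∈ corner M Ω, ω (star S * S) = ω (S * star S)) {u T : H →L[ℂ] H}
    (hu : u ∈ M.commutant) (hue : Commute u (L2proj M Ω)) (huu : star u * u = 1)
    (hT : T ∈ corner M Ω) : ω (u * T * star u) = ω T := by
  let g : (H →L[ℂ] H) →ₗ[ℂ] ℂ :=
    ω ∘ₗ (LinearMap.mulRight ℂ (star u)) ∘ₗ (LinearMap.mulLeft ℂ u)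
  refine corner_linearMap_ext (f := g) (g := ω) (fun S hS => ?_) hT
  change ω (u * (star S * S) * star u) = ω (star S * S)
  have h1 := hω _ (mul_star_mem_corner hu hue hS)
  rw [star_mul, star_star, mul_assoc S, ← mul_assoc (star u), huu, one_mul] at h1
  rw [hω S hS, ← h1]
  simp only [mul_assoc]

/-- An operator in the corner that commutes with all unitaries of the commutant that preserve
`L²(M)` is central in the corner. -/
theorem commute_corner_of_commute_unitary {X : H →L[ℂ] H}
    (h : ∀ u ∈ M.commutant, Commute u (L2proj M Ω) → star u * u = 1 → u * star u = 1 →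
      Commute X u) {S : H →L[ℂ] H} (hS : S ∈ corner M Ω) : Commute X S := by
  -- A self-adjoint contraction is the mean of the unitary `a + i √(1 - a²)` and its adjoint. As `1`
  -- is the identity of `H`, this unitary lies in `M'` and commutes with the projection onto
  -- `L²(M)`, without lying in the corner.
  have hsa : ∀ a ∈ corner M Ω, IsSelfAdjoint a → ‖a‖ ≤ 1 → Commute X a := by
    intro a ha hsa hn
    set s := CFC.sqrt (1 - a ^ 2 : H →L[ℂ] H) with hs
    have hsc : ∀ b, Commute a b → Commute s b := by
      intro b hb
      have h1 : Commute (1 - a ^ 2) b := (Commute.one_left b).sub_left (hb.pow_left 2)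
      have h2 := h1.cfc_nnreal NNReal.sqrt
      rwa [← CFC.sqrt_eq_cfc] at h2
    have hsM : s ∈ M.commutant := by
      rw [VonNeumannAlgebra.mem_commutant_iff]
      intro b hb
      exact (hsc b (VonNeumannAlgebra.mem_commutant_iff.1 ha.1 b hb).symm).eq.symm
    have hae : Commute a (L2proj M Ω) := ha.2.2.trans ha.2.1.symm
    have hssa : star s = s := (CFC.sqrt_nonneg (1 - a ^ 2 : H →L[ℂ] H)).isSelfAdjoint
    have hU := hsa.self_add_I_smul_cfcSqrt_sub_sq_mem_unitary _ hn
    rw [← hs] at hU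
    have hIs : Complex.I • s ∈ M.commutant := M.commutant.toStarSubalgebra.smul_mem hsM _
    have hmem := add_mem ha.1 hIs
    have hcom : Commute (a + Complex.I • s) (L2proj M Ω) :=
      hae.add_left ((hsc _ hae).smul_left _)
    have c1 := h _ hmem hcom (Unitary.star_mul_self_of_mem hU) (Unitary.mul_star_self_of_mem hU)
    have hcom' : Commute (star (a + Complex.I • s)) (L2proj M Ω) := by
      have := congrArg star hcom.eq
      rw [star_mul, star_mul, star_starProjection] at this
      exact this.symm
    have c2 := h _ (star_mem hmem) hcom' (by rw [star_star]; exact Unitary.mul_star_self_of_mem hU)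
      (by rw [star_star]; exact Unitary.star_mul_self_of_mem hU)
    have e : a = (2⁻¹ : ℂ) • ((a + Complex.I • s) + star (a + Complex.I • s)) := by
      rw [star_add, star_smul, hssa, hsa.star_eq, Complex.star_def, Complex.conj_I]
      module
    rw [e]
    exact (c1.add_right c2).smul_right _
  have hsa' : ∀ a ∈ corner M Ω, IsSelfAdjoint a → Commute X a := by
    intro a ha hs
    have hpos : (0 : ℝ) < ‖a‖ + 1 := by positivity
    have hne : (((‖a‖ + 1 : ℝ)) : ℂ) ≠ 0 := by exact_mod_cast hpos.ne'
    have hconj : IsSelfAdjoint ((((‖a‖ + 1 : ℝ)) : ℂ)⁻¹) := by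
      rw [IsSelfAdjoint, Complex.star_def, map_inv₀, Complex.conj_ofReal]
    have hn : ‖((((‖a‖ + 1 : ℝ)) : ℂ)⁻¹) • a‖ ≤ 1 := by
      rw [norm_smul, norm_inv, Complex.norm_of_nonneg hpos.le, inv_mul_le_one₀ hpos]
      linarith
    have h1 := (hsa _ (SMulMemClass.smul_mem ((((‖a‖ + 1 : ℝ)) : ℂ)⁻¹) ha) (hconj.smul hs)
      hn).smul_right (((‖a‖ + 1 : ℝ)) : ℂ)
    rwa [smul_smul, mul_inv_cancel₀ hne, one_smul] at h1
  have e : S = (2⁻¹ : ℂ) • (S + star S) + (-Complex.I * 2⁻¹) • (Complex.I • (S - star S)) := by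
    rw [smul_smul, show -Complex.I * 2⁻¹ * Complex.I = 2⁻¹ by
      linear_combination (-2⁻¹ : ℂ) * Complex.I_mul_I]
    module
  rw [e]
  refine ((hsa' _ (add_mem hS (star_mem hS)) (IsSelfAdjoint.add_star_self S)).smul_right _).add_right
    ((hsa' _ (SMulMemClass.smul_mem _ (sub_mem hS (star_mem hS))) ?_).smul_right _)
  rw [IsSelfAdjoint, star_smul, star_sub, star_star, Complex.star_def, Complex.conj_I]
  module

/-- Uniqueness of the trace on the corner of a factor, in the form of a vanishing statement. -/
theorem IsTraceVector.trace_eq_zero (h : IsTraceVector M Ω) (hM : IsFactor M)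
    {ω : (H →L[ℂ] H) →ₗ[ℂ] ℂ}
    (hω : ∀ S ∈ corner M Ω, ω (star S * S) = ω (S * star S))
    (hcont : ∀ (T : ℕ → H →L[ℂ] H) (S : H →L[ℂ] H) (r : ℝ), (∀ n, ‖T n‖ ≤ r) →
      (∀ x, Tendsto (fun n => T n x) atTop (𝓝 (S x))) →
      Tendsto (fun n => ω (T n)) atTop (𝓝 (ω S)))
    (h0 : ω (L2proj M Ω) = 0) {T : H →L[ℂ] H} (hT : T ∈ corner M Ω) : ω T = 0 := by
  let : InnerProductSpace ℝ H := InnerProductSpace.rclikeToReal ℂ H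
  -- The averaging argument: `W` is stable under conjugation by the relevant unitaries, and the
  -- vector of least norm in `V = W Ω` comes from a central element.
  let W : Set (H →L[ℂ] H) := {S | S ∈ corner M Ω ∧ ‖S‖ ≤ ‖T‖ ∧ ω S = ω T}
  let V : Set H := (fun S : H →L[ℂ] H => S Ω) '' W
  have hne : V.Nonempty := ⟨T Ω, T, ⟨hT, le_rfl, rfl⟩, rfl⟩
  have hclosed : IsClosed V := by
    rw [← isSeqClosed_iff_isClosed]
    intro x ξ hx hlim
    choose R hR hRx using hx
    have hx' : x = fun n => R n Ω := funext fun n => (hRx n).symm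
    subst hx'
    obtain ⟨S, hS, hSn, hSlim⟩ :=
      exists_strong_limit_of_corner (fun n => (hR n).1) (fun n => (hR n).2.1) hlim
    refine ⟨S, ⟨hS, hSn, ?_⟩, tendsto_nhds_unique (hSlim Ω) hlim⟩
    refine tendsto_nhds_unique (hcont R S _ (fun n => (hR n).2.1) hSlim) ?_
    exact tendsto_const_nhds.congr fun n => (hR n).2.2.symm
  have hconv : Convex ℝ V := by
    rintro _ ⟨S, ⟨hS, hSn, hSω⟩, rfl⟩ _ ⟨R, ⟨hR, hRn, hRω⟩, rfl⟩ a b ha hb hab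
    refine ⟨(a : ℂ) • S + (b : ℂ) • R, ⟨add_mem (SMulMemClass.smul_mem _ hS)
      (SMulMemClass.smul_mem _ hR), ?_, ?_⟩, ?_⟩
    · calc ‖(a : ℂ) • S + (b : ℂ) • R‖ ≤ a * ‖S‖ + b * ‖R‖ := by
            refine (norm_add_le _ _).trans (le_of_eq ?_)
            rw [norm_smul, norm_smul, Complex.norm_of_nonneg ha, Complex.norm_of_nonneg hb]
        _ ≤ a * ‖T‖ + b * ‖T‖ := by gcongr
        _ = ‖T‖ := by rw [← add_mul, hab, one_mul]
    · rw [map_add, map_smul, map_smul, hSω, hRω, ← add_smul, ← Complex.ofReal_add, hab,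
        Complex.ofReal_one, one_smul]
    · simp [Complex.coe_smul]
  obtain ⟨v, hv, hvmin⟩ := exists_norm_eq_iInf_of_complete_convex hne hclosed.isComplete hconv 0
  obtain ⟨X, hX, rfl⟩ := hv
  have hmin : ∀ w ∈ V, ‖X Ω‖ ≤ ‖w‖ := by
    intro w hw
    have h1 := ciInf_le (f := fun w : V => ‖(0 : H) - w‖)
      ⟨0, by rintro _ ⟨z, rfl⟩; positivity⟩ ⟨w, hw⟩
    rw [← hvmin] at h1
    simpa using h1
  have huniq : ∀ w ∈ V, ‖w‖ = ‖X Ω‖ → w = X Ω := by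
    intro w hw hn
    by_contra hne'
    have h1 := hmin _ (hconv hw ⟨X, hX, rfl⟩ (a := 1 / 2) (b := 1 / 2)
      (by norm_num) (by norm_num) (by norm_num))
    have h2 := combo_mem_ball_of_ne (E := H) (x := w) (y := X Ω) (z := 0) (r := ‖X Ω‖)
      (a := 1 / 2) (b := 1 / 2) (by simp [hn]) (by simp) hne' (by norm_num) (by norm_num)
      (by norm_num)
    rw [mem_ball_zero_iff] at h2
    exact absurd h1 (not_le.2 h2)
  have hcomm : ∀ u ∈ M.commutant, Commute u (L2proj M Ω) → star u * u = 1 → u * star u = 1 →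
      Commute X u := by
    intro u hu hue huu huu'
    have hmem := conj_mem_corner hu hue hX.1
    have hnu : ∀ x, ‖u x‖ = ‖x‖ := by
      intro x
      have h1 := norm_sq_apply_eq u x
      have h2 := norm_sq_apply_eq (1 : H →L[ℂ] H) x
      rw [huu] at h1
      rw [star_one, one_mul, ← h1] at h2
      exact ((sq_eq_sq₀ (norm_nonneg _) (norm_nonneg _)).1 (by exact_mod_cast h2)).symm
    have hopu : ‖u‖ ≤ 1 := u.opNorm_le_bound zero_le_one fun x => by rw [hnu, one_mul]
    have hops : ‖star u‖ ≤ 1 := by rwa [norm_star]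
    have hW : u * X * star u ∈ W := by
      refine ⟨hmem, ?_, ?_⟩
      · calc ‖u * X * star u‖ ≤ ‖u‖ * ‖X‖ * ‖star u‖ :=
              (norm_mul_le _ _).trans (by gcongr; exact norm_mul_le _ _)
          _ ≤ 1 * ‖X‖ * 1 := by gcongr
          _ ≤ ‖T‖ := by rw [one_mul, mul_one]; exact hX.2.1
      · rw [trace_conj_corner hω hu hue huu hX.1]; exact hX.2.2
    -- The unitary on the left is isometric, and the one on the right becomes a left factor after
    -- passing to the adjoint, which does not change the norm at `Ω`.
    have hnorm : ‖(u * X * star u) Ω‖ = ‖X Ω‖ := by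
      rw [mul_assoc, mul_apply_eq_comp, hnu, ← h.norm_star_apply_of_mem_corner
        (mul_star_mem_corner hu hue hX.1), star_mul, star_star, mul_apply_eq_comp, hnu,
        h.norm_star_apply_of_mem_corner hX.1]
    have heq := corner_ext hmem hX.1 (huniq _ ⟨_, hW, rfl⟩ hnorm)
    have h3 := congrArg (· * u) heq
    simp only [mul_assoc, huu, mul_one] at h3
    exact h3.symm
  obtain ⟨c, hc⟩ := h.corner_center hM hX.1
    (fun S hS => commute_corner_of_commute_unitary hcomm hS)
  rw [← hX.2.2, hc, map_smul, h0, smul_zero]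

end TraceUniqueness

/-! ### Parseval frames of modules and the Murray–von Neumann dimension -/

section Frames

variable {H : Type*} [NormedAddCommGroup H] [InnerProductSpace ℂ H] [CompleteSpace H]

/-- A Parseval frame of the `N`-module `K`, by its coefficient maps `C i : K → L²(N)`, which are
extended by `0` to `H`. -/
structure IsModuleFrame (N : VonNeumannAlgebra H) (Ω : H) (K : Submodule ℂ H) [CompleteSpace K]
    {ι : Type*} (C : ι → H →L[ℂ] H) : Prop where
  mem_commutant : ∀ i, C i ∈ N.commutant
  apply_mem : ∀ i x, C i x ∈ L2 N Ω
  tsum_eq : ∀ x, ∑' i, ‖C i x‖ₑ ^ 2 = ‖K.starProjection x‖ₑ ^ 2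

variable {N P M : VonNeumannAlgebra H} {Ω : H} {K : Submodule ℂ H} [CompleteSpace K]
  {ι κ : Type*} {C : ι → H →L[ℂ] H} {B : κ → H →L[ℂ] H}

/-- The Parseval identity forces `C i` to vanish on the orthogonal complement of `K`. -/
theorem IsModuleFrame.star_apply_mem (h : IsModuleFrame N Ω K C) (i : ι) (x : H) :
    star (C i) x ∈ K := by
  rw [← K.orthogonal_orthogonal, Submodule.mem_orthogonal']
  intro y hy
  have hy0 : K.starProjection y = 0 := (Submodule.starProjection_apply_eq_zero_iff K).2 hy
  have h1 := (ENNReal.le_tsum i).trans (h.tsum_eq y).le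
  rw [hy0] at h1
  have h2 : C i y = 0 := by simpa using h1
  rw [inner_star_left, h2, inner_zero_right]

theorem IsModuleFrame.tsum_eq_of_mem (h : IsModuleFrame N Ω K C) {x : H} (hx : x ∈ K) :
    ∑' i, ‖C i x‖ₑ ^ 2 = ‖x‖ₑ ^ 2 := by
  rw [h.tsum_eq, Submodule.starProjection_eq_self_iff.2 hx]

/-- For an `N`-linear map `S` of `K`, the Hilbert–Schmidt type sums of `S` and `S*` agree. -/
theorem IsModuleFrame.tsum_comm (hN : IsTraceVector N Ω) (hC : IsModuleFrame N Ω K C)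
    (hB : IsModuleFrame N Ω K B) {S : H →L[ℂ] H} (hS : S ∈ N.commutant)
    (hSK : ∀ x ∈ K, S x ∈ K) (hSK' : ∀ x ∈ K, star S x ∈ K) :
    ∑' i, ‖S (star (C i) Ω)‖ₑ ^ 2 = ∑' j, ‖star S (star (B j) Ω)‖ₑ ^ 2 := by
  calc ∑' i, ‖S (star (C i) Ω)‖ₑ ^ 2
      = ∑' i, ∑' j, ‖B j (S (star (C i) Ω))‖ₑ ^ 2 :=
        tsum_congr fun i => (hB.tsum_eq_of_mem (hSK _ (hC.star_apply_mem i Ω))).symm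
    _ = ∑' i, ∑' j, ‖C i (star S (star (B j) Ω))‖ₑ ^ 2 := by
        refine tsum_congr fun i => tsum_congr fun j => ?_
        -- This operator and its adjoint commute with `N` and send `Ω` into `L²(N)`, so the trace
        -- property of the commutant applies to it, even though neither `B j` nor `C i` need
        -- preserve `L²(N)`.
        have hT : B j * (S * star (C i)) ∈ N.commutant :=
          mul_mem (hB.mem_commutant j) (mul_mem hS (star_mem (hC.mem_commutant i)))
        have e : star (B j * (S * star (C i))) = C i * (star S * star (B j)) := by
          rw [star_mul, star_mul, star_star, mul_assoc]
        have := hN.norm_star_apply hT (hB.apply_mem j _) (by rw [e]; exact hC.apply_mem i _)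
        rw [e] at this
        change ‖(B j * (S * star (C i))) Ω‖ₑ ^ 2 = ‖(C i * (star S * star (B j))) Ω‖ₑ ^ 2
        rw [← ofReal_norm, ← ofReal_norm, this]
    _ = ∑' j, ∑' i, ‖C i (star S (star (B j) Ω))‖ₑ ^ 2 := ENNReal.tsum_comm
    _ = ∑' j, ‖star S (star (B j) Ω)‖ₑ ^ 2 :=
        tsum_congr fun j => hC.tsum_eq_of_mem (hSK' _ (hB.star_apply_mem j Ω))

theorem IsModuleFrame.tsum_star_eq (hN : IsTraceVector N Ω) (hC : IsModuleFrame N Ω K C)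
    (hB : IsModuleFrame N Ω K B) :
    ∑' i, ‖star (C i) Ω‖ₑ ^ 2 = ∑' j, ‖star (B j) Ω‖ₑ ^ 2 := by
  have := hC.tsum_comm hN hB (one_mem _) (fun x hx => hx) (fun x hx => by simpa using hx)
  simpa using this

theorem IsModuleFrame.reindex (h : IsModuleFrame N Ω K C) (e : κ ≃ ι) :
    IsModuleFrame N Ω K (C ∘ e) where
  mem_commutant _ := h.mem_commutant _
  apply_mem _ x := h.apply_mem _ x
  tsum_eq x := (e.tsum_eq fun i => ‖C i x‖ₑ ^ 2).trans (h.tsum_eq x)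

/-- The compression of a frame to a submodule. -/
theorem IsModuleFrame.restrict (h : IsModuleFrame N Ω K C) {L : Submodule ℂ H} [CompleteSpace L]
    (hle : L ≤ K) (hKL : ∀ a ∈ N, ∀ x ∈ L, a x ∈ L) :
    IsModuleFrame N Ω L fun i => C i * L.starProjection where
  mem_commutant i := mul_mem (h.mem_commutant i) (starProjection_mem_commutant hKL)
  apply_mem i _ := h.apply_mem i _
  tsum_eq x := h.tsum_eq_of_mem (hle (Submodule.starProjection_apply_mem L x))

/-- Composition of a frame over `P` with a frame of `L²(P)` over `N`. -/
theorem IsModuleFrame.comp (hC : IsModuleFrame P Ω K C) (hB : IsModuleFrame N Ω (L2 P Ω) B)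
    (hle : N ≤ P) : IsModuleFrame N Ω K fun q : ι × κ => B q.2 * C q.1 where
  mem_commutant q := mul_mem (hB.mem_commutant _) (commutant_le_commutant hle (hC.mem_commutant _))
  apply_mem q x := hB.apply_mem _ _
  tsum_eq x := by
    rw [ENNReal.tsum_prod', ← hC.tsum_eq x]
    exact tsum_congr fun i => hB.tsum_eq_of_mem (hC.apply_mem i x)

/-- The frame with one nonzero member, padded by zeros to be indexed by `ℕ`; it gives `[M : M] = 1`.
-/
theorem isModuleFrame_self (M : VonNeumannAlgebra H) (Ω : H) :
    IsModuleFrame M Ω (L2 M Ω) fun i : ℕ => if i = 0 then L2proj M Ω else 0 where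
  mem_commutant i := by
    split_ifs
    exacts [L2proj_mem_commutant M Ω, zero_mem _]
  apply_mem i x := by
    split_ifs
    exacts [L2proj_apply_mem M Ω x, zero_mem _]
  tsum_eq x := by
    rw [tsum_eq_single 0 fun i hi => by simp [hi]]
    simp

/-! ### Isometries into `L²(N) ⊗ ℓ²(ℕ)` as frames -/

section Coefficients

variable (v : K →ₗᵢ[ℂ] lp (fun _ : ℕ => L2 N Ω) 2)

/-- The coefficient maps of an isometry into `L²(N) ⊗ ℓ²(ℕ)`. -/
def coefficient (i : ℕ) : H →L[ℂ] H :=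
  (L2 N Ω).subtypeL ∘L lp.evalCLM ℂ (fun _ : ℕ => L2 N Ω) 2 i ∘L
    v.toContinuousLinearMap ∘L K.orthogonalProjectionOnto

theorem coefficient_apply (i : ℕ) (x : H) :
    coefficient v i x = ((v (K.orthogonalProjectionOnto x) i : L2 N Ω) : H) := rfl

theorem enorm_sq_eq_tsum_lp {E : ℕ → Type*} [∀ i, NormedAddCommGroup (E i)] (x : lp E 2) :
    ‖x‖ₑ ^ 2 = ∑' i, ‖x i‖ₑ ^ 2 := by
  have h := lp.hasSum_norm (p := 2) (by norm_num) x
  simp only [ENNReal.toReal_ofNat, Real.rpow_ofNat] at h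
  have h2 := ENNReal.ofReal_tsum_of_nonneg (fun i => sq_nonneg ‖x i‖) h.summable
  rw [h.tsum_eq, ENNReal.ofReal_pow (norm_nonneg _), ofReal_norm] at h2
  rw [h2]
  refine tsum_congr fun i => ?_
  rw [ENNReal.ofReal_pow (norm_nonneg _), ofReal_norm]

theorem isModuleFrame_coefficient (hK : ∀ a ∈ N, ∀ x ∈ K, a x ∈ K)
    (hv : ∀ n ∈ N, ∀ ξ η : K, (η : H) = n (ξ : H) →
      ∀ i : ℕ, ((v η i : L2 N Ω) : H) = n ((v ξ i : L2 N Ω) : H)) :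
    IsModuleFrame N Ω K (coefficient v) where
  mem_commutant i := by
    rw [VonNeumannAlgebra.mem_commutant_iff]
    intro a ha
    ext x
    change a (coefficient v i x) = coefficient v i (a x)
    rw [coefficient_apply, coefficient_apply]
    refine (hv a ha _ _ ?_ i).symm
    exact commute_apply (starProjection_mem_commutant hK) ha x
  apply_mem i x := (v (K.orthogonalProjectionOnto x) i).2
  tsum_eq x := by
    change ∑' i, ‖v (K.orthogonalProjectionOnto x) i‖ₑ ^ 2 = ‖K.orthogonalProjectionOnto x‖ₑ ^ 2
    rw [← enorm_sq_eq_tsum_lp, v.enorm_map]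

/-- This translates the summands in the definition of `murrayVonNeumannDim` into the frame sum. -/
theorem star_coefficient_apply (i : ℕ) :
    star (coefficient v i) Ω = ((ContinuousLinearMap.adjoint v.toContinuousLinearMap
      (lp.single 2 i (⟨Ω, trace_vector_mem_L2 N Ω⟩ : L2 N Ω)) : K) : H) := by
  refine ext_inner_right ℂ fun x => ?_
  rw [inner_star_left, coefficient_apply]
  refine (lp.inner_single_left (𝕜 := ℂ) i (⟨Ω, trace_vector_mem_L2 N Ω⟩ : L2 N Ω)
    (v (K.orthogonalProjectionOnto x))).symm.trans ?_
  refine (ContinuousLinearMap.adjoint_inner_left v.toContinuousLinearMap _ _).symm.trans ?_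
  exact Submodule.inner_orthogonalProjectionOnto_eq_of_mem_left _ x

end Coefficients

/-- A frame indexed by `ℕ` gives an isometry into `L²(N) ⊗ ℓ²(ℕ)`. -/
theorem IsModuleFrame.exists_isometry {C : ℕ → H →L[ℂ] H} (h : IsModuleFrame N Ω K C) :
    ∃ v : K →ₗᵢ[ℂ] lp (fun _ : ℕ => L2 N Ω) 2,
      ∀ (ξ : K) (i : ℕ), ((v ξ i : L2 N Ω) : H) = C i ξ := by
  have hsum : ∀ ξ : K, ∑' i, ‖(⟨C i ξ, h.apply_mem i ξ⟩ : L2 N Ω)‖ₑ ^ 2 = ‖ξ‖ₑ ^ 2 :=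
    fun ξ => h.tsum_eq_of_mem ξ.2
  have hmem : ∀ ξ : K, Memℓp (fun i => (⟨C i ξ, h.apply_mem i ξ⟩ : L2 N Ω)) 2 := by
    intro ξ
    refine memℓp_gen ?_
    simp only [ENNReal.toReal_ofNat, Real.rpow_ofNat]
    have h1 : ∑' i, ‖(⟨C i ξ, h.apply_mem i ξ⟩ : L2 N Ω)‖ₑ ^ 2 ≠ ⊤ := by
      rw [hsum]; exact ENNReal.pow_ne_top enorm_ne_top
    have h2 := ENNReal.summable_toReal h1
    simpa using h2
  let L : K →ₗ[ℂ] lp (fun _ : ℕ => L2 N Ω) 2 :=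
    { toFun := fun ξ => ⟨fun i => ⟨C i ξ, h.apply_mem i ξ⟩, hmem ξ⟩
      map_add' := fun x y => by
        ext i
        exact map_add (C i) _ _
      map_smul' := fun c x => by
        ext i
        exact map_smul (C i) _ _ }
  refine ⟨⟨L, fun ξ => ?_⟩, fun ξ i => rfl⟩
  have h3 : ‖L ξ‖ₑ ^ 2 = ‖ξ‖ₑ ^ 2 := (enorm_sq_eq_tsum_lp _).trans (hsum ξ)
  have h4 := congrArg ENNReal.toReal h3
  simp only [ENNReal.toReal_pow, toReal_enorm] at h4
  exact (sq_eq_sq₀ (norm_nonneg _) (norm_nonneg _)).1 h4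

theorem IsModuleFrame.invariant_coefficient {C : ℕ → H →L[ℂ] H} (h : IsModuleFrame N Ω K C)
    {v : K →ₗᵢ[ℂ] lp (fun _ : ℕ => L2 N Ω) 2}
    (hv : ∀ (ξ : K) (i : ℕ), ((v ξ i : L2 N Ω) : H) = C i ξ) :
    ∀ n ∈ N, ∀ ξ η : K, (η : H) = n (ξ : H) →
      ∀ i : ℕ, ((v η i : L2 N Ω) : H) = n ((v ξ i : L2 N Ω) : H) := by
  intro n hn ξ η e i
  rw [hv, hv, e, commute_apply (h.mem_commutant i) hn]

/-- Every frame computes the Murray–von Neumann dimension. -/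
theorem IsModuleFrame.dim_eq (hN : IsTraceVector N Ω) (hK : ∀ a ∈ N, ∀ x ∈ K, a x ∈ K)
    {C : ℕ → H →L[ℂ] H} (h : IsModuleFrame N Ω K C) :
    murrayVonNeumannDim N Ω K = ∑' i, ‖star (C i) Ω‖ₑ ^ 2 := by
  -- The quantity under the infimum is the same for every admissible isometry.
  have key : ∀ v : K →ₗᵢ[ℂ] lp (fun _ : ℕ => L2 N Ω) 2,
      (∀ n ∈ N, ∀ ξ η : K, (η : H) = n (ξ : H) →
        ∀ i : ℕ, ((v η i : L2 N Ω) : H) = n ((v ξ i : L2 N Ω) : H)) →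
      ∑' i : ℕ, ‖ContinuousLinearMap.adjoint v.toContinuousLinearMap
        (lp.single 2 i (⟨Ω, trace_vector_mem_L2 N Ω⟩ : L2 N Ω))‖ₑ ^ 2
        = ∑' i, ‖star (C i) Ω‖ₑ ^ 2 := by
    intro v hv
    rw [← (isModuleFrame_coefficient v hK hv).tsum_star_eq hN h]
    refine tsum_congr fun i => ?_
    rw [star_coefficient_apply]
    rfl
  obtain ⟨v, hv⟩ := h.exists_isometry
  have hv' := h.invariant_coefficient hv
  refine le_antisymm ?_ ?_
  · exact (iInf₂_le v hv').trans (key v hv').le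
  · exact le_iInf₂ fun w hw => (key w hw).ge

/-- An infimum over the empty family is `⊤`, so a finite dimension provides an isometry. -/
theorem exists_frame_of_dim_lt_top (hK : ∀ a ∈ N, ∀ x ∈ K, a x ∈ K)
    (h : murrayVonNeumannDim N Ω K < ⊤) : ∃ C : ℕ → H →L[ℂ] H, IsModuleFrame N Ω K C := by
  obtain ⟨v, hv⟩ := iInf_lt_top.1 h
  obtain ⟨hv, -⟩ := iInf_lt_top.1 hv
  exact ⟨_, isModuleFrame_coefficient v hK hv⟩

end Frames

/-! ### Multiplicativity, monotonicity and positivity of the index -/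

section Multiplicativity

variable {H : Type*} [NormedAddCommGroup H] [InnerProductSpace ℂ H]

theorem summable_inner_apply {η : ℕ → H} (hη : Summable fun j => ‖η j‖ ^ 2) (T : H →L[ℂ] H) :
    Summable fun j => ⟪η j, T (η j)⟫_ℂ := by
  refine Summable.of_norm_bounded (hη.mul_left ‖T‖) fun j => ?_
  calc ‖⟪η j, T (η j)⟫_ℂ‖ ≤ ‖η j‖ * (‖T‖ * ‖η j‖) :=
        (norm_inner_le_norm _ _).trans (by gcongr; exact T.le_opNorm _)
    _ = ‖T‖ * ‖η j‖ ^ 2 := by ring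

/-- The normal functional `T ↦ ∑ j, ⟨η j, T η j⟩`. -/
def normalFunctional (η : ℕ → H) (hη : Summable fun j => ‖η j‖ ^ 2) :
    (H →L[ℂ] H) →ₗ[ℂ] ℂ where
  toFun T := ∑' j, ⟪η j, T (η j)⟫_ℂ
  map_add' S T := by
    rw [← (summable_inner_apply hη S).tsum_add (summable_inner_apply hη T)]
    simp
  map_smul' c T := by
    rw [RingHom.id_apply, smul_eq_mul, ← tsum_mul_left]
    simp

theorem normalFunctional_apply {η : ℕ → H} (hη : Summable fun j => ‖η j‖ ^ 2) (T : H →L[ℂ] H) :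
    normalFunctional η hη T = ∑' j, ⟪η j, T (η j)⟫_ℂ := rfl

theorem tendsto_normalFunctional {η : ℕ → H} (hη : Summable fun j => ‖η j‖ ^ 2)
    {T : ℕ → H →L[ℂ] H} {S : H →L[ℂ] H} {r : ℝ} (hr : ∀ n, ‖T n‖ ≤ r)
    (hT : ∀ x, Tendsto (fun n => T n x) atTop (𝓝 (S x))) :
    Tendsto (fun n => normalFunctional η hη (T n)) atTop (𝓝 (normalFunctional η hη S)) := by
  refine tendsto_tsum_of_dominated_convergence (hη.mul_left r)
    (fun j => tendsto_const_nhds.inner (hT (η j))) (Eventually.of_forall fun n j => ?_)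
  calc ‖⟪η j, T n (η j)⟫_ℂ‖ ≤ ‖η j‖ * (‖T n‖ * ‖η j‖) :=
        (norm_inner_le_norm _ _).trans (by gcongr; exact (T n).le_opNorm _)
    _ ≤ ‖η j‖ * (r * ‖η j‖) := by gcongr; exact hr n
    _ = r * ‖η j‖ ^ 2 := by ring

variable [CompleteSpace H] {N P M : VonNeumannAlgebra H} {Ω : H}

theorem normalFunctional_star_mul_self {η : ℕ → H} (hη : Summable fun j => ‖η j‖ ^ 2)
    (T : H →L[ℂ] H) :
    normalFunctional η hη (star T * T) = ((∑' j, ‖T (η j)‖ₑ ^ 2).toReal : ℂ) := by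
  rw [normalFunctional_apply, ENNReal.tsum_toReal_eq fun j => ENNReal.pow_ne_top enorm_ne_top,
    Complex.ofReal_tsum]
  refine tsum_congr fun j => ?_
  rw [← norm_sq_apply_eq, ENNReal.toReal_pow, toReal_enorm]

/-- Over a factor `P`, the trace defined by a frame of `L²(P)` over a subalgebra is a multiple of
the trace of the commutant of `P` on `L²(P)`. -/
theorem IsModuleFrame.tsum_apply_star (hP : IsTraceVector P Ω) (hF : IsFactor P) (hle : N ≤ P)
    {B : ℕ → H →L[ℂ] H} (hB : IsModuleFrame N Ω (L2 P Ω) B)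
    (hfin : ∑' j, ‖star (B j) Ω‖ₑ ^ 2 ≠ ⊤) {R : H →L[ℂ] H} (hR : star R * R ∈ corner P Ω) :
    ∑' j, ‖R (star (B j) Ω)‖ₑ ^ 2 = ‖R Ω‖ₑ ^ 2 * ∑' j, ‖star (B j) Ω‖ₑ ^ 2 := by
  have hη : Summable fun j => ‖star (B j) Ω‖ ^ 2 := by
    simpa using ENNReal.summable_toReal hfin
  have hη' : ∀ T : H →L[ℂ] H, ∑' j, ‖T (star (B j) Ω)‖ₑ ^ 2 ≠ ⊤ := by
    intro T
    have hs : ∑' j, ‖T (star (B j) Ω)‖ₑ ^ 2 ≤ ‖T‖ₑ ^ 2 * ∑' j, ‖star (B j) Ω‖ₑ ^ 2 := by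
      rw [← ENNReal.tsum_mul_left]
      refine ENNReal.tsum_le_tsum fun j => ?_
      rw [← mul_pow]
      gcongr
      exact T.le_opENorm _
    exact ne_top_of_le_ne_top (ENNReal.mul_ne_top (ENNReal.pow_ne_top enorm_ne_top) hfin) hs
  set φ := normalFunctional (fun j => star (B j) Ω) hη with hφ
  have hΩ : Summable fun j : ℕ => ‖(if j = 0 then Ω else 0 : H)‖ ^ 2 :=
    summable_of_ne_finset_zero (s := {0}) fun j hj => by simp at hj; simp [hj]
  -- The vector functional of `Ω`, written as a normal functional so that the same continuity lemma
  -- covers it.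
  set τ := normalFunctional (fun j => if j = 0 then Ω else 0) hΩ with hτ
  have hτapp : ∀ T, τ T = ⟪Ω, T Ω⟫_ℂ := fun T => by
    rw [hτ, normalFunctional_apply, tsum_eq_single 0 fun j hj => by simp [hj]]
    simp
  set e := L2proj P Ω
  have he : star e * e = e := by
    rw [star_starProjection]; exact L2proj_mul_self P Ω
  have hφe : φ e = ((∑' j, ‖star (B j) Ω‖ₑ ^ 2).toReal : ℂ) := by
    rw [← he, hφ, normalFunctional_star_mul_self]
    congr 2
    exact tsum_congr fun j => by rw [L2proj_apply_of_mem (hB.star_apply_mem j Ω)]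
  -- Both functionals are normal traces on the corner and `τ e = 1`, so the difference is a normal
  -- trace that vanishes at `e`. The trace property of `φ` is `IsModuleFrame.tsum_comm` with the
  -- same frame on both sides.
  have hzero : (φ - φ e • τ) (star R * R) = 0 := by
    refine hP.trace_eq_zero hF (fun S hS => ?_) (fun T S r hr hT => ?_) ?_ hR
    · have h1 : φ (star S * S) = φ (S * star S) := by
        have h2 := normalFunctional_star_mul_self hη (star S)
        rw [star_star] at h2
        rw [hφ, h2, normalFunctional_star_mul_self]
        congr 2
        exact hB.tsum_comm (hP.mono hle) hB (commutant_le_commutant hle hS.1)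
          (fun x _ => corner_apply_mem hS x) (fun x _ => corner_apply_mem (star_mem hS) x)
      have h2 : τ (star S * S) = τ (S * star S) := by
        have h3 := norm_sq_apply_eq (star S) Ω
        rw [star_star] at h3
        rw [hτapp, hτapp, ← h3, ← norm_sq_apply_eq, hP.norm_star_apply_of_mem_corner hS]
      rw [LinearMap.sub_apply, LinearMap.sub_apply, LinearMap.smul_apply, LinearMap.smul_apply,
        h1, h2]
    · exact (tendsto_normalFunctional hη hr hT).sub
        ((tendsto_normalFunctional hΩ hr hT).const_smul (φ e))
    · rw [LinearMap.sub_apply, LinearMap.smul_apply, hτapp,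
        L2proj_apply_of_mem (trace_vector_mem_L2 P Ω), inner_self_eq_norm_sq_to_K, hP.norm_eq_one]
      simp [e]
  rw [LinearMap.sub_apply, LinearMap.smul_apply, hτapp, ← norm_sq_apply_eq, hφe, hφ,
    normalFunctional_star_mul_self, sub_eq_zero, smul_eq_mul] at hzero
  have h4 : (∑' j, ‖R (star (B j) Ω)‖ₑ ^ 2).toReal
      = (∑' j, ‖star (B j) Ω‖ₑ ^ 2).toReal * ‖R Ω‖ ^ 2 := by exact_mod_cast hzero
  rw [← ENNReal.toReal_eq_toReal_iff' (hη' R)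
    (ENNReal.mul_ne_top (ENNReal.pow_ne_top enorm_ne_top) hfin), h4, ENNReal.toReal_mul,
    ENNReal.toReal_pow, toReal_enorm, mul_comm]

theorem L2_invariant_of_le (hle : N ≤ M) : ∀ a ∈ N, ∀ x ∈ L2 M Ω, a x ∈ L2 M Ω :=
  fun _ ha _ hx => L2_invariant (hle ha) hx

theorem exists_frame_of_jonesIndex_lt_top (hle : N ≤ M) (h : jonesIndex Ω M N < ⊤) :
    ∃ C : ℕ → H →L[ℂ] H, IsModuleFrame N Ω (L2 M Ω) C :=
  exists_frame_of_dim_lt_top (L2_invariant_of_le hle) h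

theorem IsModuleFrame.jonesIndex_eq (hM : IsTraceVector M Ω) (hle : N ≤ M)
    {C : ℕ → H →L[ℂ] H} (hC : IsModuleFrame N Ω (L2 M Ω) C) :
    jonesIndex Ω M N = ∑' i, ‖star (C i) Ω‖ₑ ^ 2 :=
  hC.dim_eq (hM.mono hle) (L2_invariant_of_le hle)

theorem jonesIndex_mul (hM : IsTraceVector M Ω) (hP : IsFactor P) (hNP : N ≤ P) (hPM : P ≤ M)
    (h₁ : jonesIndex Ω M P < ⊤) (h₂ : jonesIndex Ω P N < ⊤) :
    jonesIndex Ω M N = jonesIndex Ω M P * jonesIndex Ω P N := by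
  obtain ⟨C, hC⟩ := exists_frame_of_jonesIndex_lt_top hPM h₁
  obtain ⟨B, hB⟩ := exists_frame_of_jonesIndex_lt_top hNP h₂
  have hTP := hM.mono hPM
  rw [hB.jonesIndex_eq hTP hNP] at h₂ ⊢
  rw [hC.jonesIndex_eq hM hPM,
    ((hC.comp hB hNP).reindex Nat.pairEquiv.symm).jonesIndex_eq hM (hNP.trans hPM),
    ← ENNReal.tsum_mul_right]
  refine (Nat.pairEquiv.symm.tsum_eq fun q : ℕ × ℕ => ‖star (B q.2 * C q.1) Ω‖ₑ ^ 2).trans ?_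
  rw [ENNReal.tsum_prod']
  refine tsum_congr fun i => ?_
  -- `(C i)*` takes values in `L²(M)` and need not lie in the corner of `P`; only `C i (C i)*` does,
  -- and `IsModuleFrame.tsum_apply_star` asks for no more.
  have hcorner : star (star (C i)) * star (C i) ∈ corner P Ω := by
    have hproj : L2proj P Ω * C i = C i := by
      ext x
      exact L2proj_apply_of_mem (hC.apply_mem i x)
    have hproj' := congrArg star hproj
    rw [star_mul, star_starProjection] at hproj'
    rw [star_star]
    exact ⟨mul_mem (hC.mem_commutant i) (star_mem (hC.mem_commutant i)),
      by rw [← mul_assoc, hproj], by rw [mul_assoc, hproj']⟩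
  rw [← hB.tsum_apply_star hTP hP hNP h₂.ne hcorner]
  exact tsum_congr fun j => by rw [star_mul]; rfl

theorem jonesIndex_self (hM : IsTraceVector M Ω) : jonesIndex Ω M M = 1 := by
  rw [(isModuleFrame_self M Ω).jonesIndex_eq hM le_rfl, tsum_eq_single 0 fun i hi => by simp [hi],
    if_pos rfl, star_starProjection, L2proj_apply_of_mem (trace_vector_mem_L2 M Ω),
    ← ofReal_norm, hM.norm_eq_one]
  simp

/-- Compressing a frame of `L²(M)` to `L²(P)` projects each `(C i)* Ω`, which cannot increase its
norm. -/
theorem jonesIndex_mono (hM : IsTraceVector M Ω) (hNP : N ≤ P) (hPM : P ≤ M) :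
    jonesIndex Ω P N ≤ jonesIndex Ω M N := by
  rcases eq_top_or_lt_top (jonesIndex Ω M N) with h | h
  · rw [h]; exact le_top
  obtain ⟨C, hC⟩ := exists_frame_of_jonesIndex_lt_top (hNP.trans hPM) h
  rw [(hC.restrict (L2_mono hPM Ω) (L2_invariant_of_le hNP)).jonesIndex_eq (hM.mono hPM) hNP,
    hC.jonesIndex_eq hM (hNP.trans hPM)]
  refine ENNReal.tsum_le_tsum fun i => ?_
  rw [star_mul, star_starProjection, mul_apply_eq_comp]
  gcongr
  rw [← ofReal_norm, ← ofReal_norm]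
  exact ENNReal.ofReal_le_ofReal (Submodule.norm_starProjection_apply_le _ _)

theorem jonesIndex_pos (hM : IsTraceVector M Ω) (hle : N ≤ M) (h : jonesIndex Ω M N < ⊤) :
    jonesIndex Ω M N ≠ 0 := by
  obtain ⟨C, hC⟩ := exists_frame_of_jonesIndex_lt_top hle h
  rw [hC.jonesIndex_eq hM hle]
  intro h0
  rw [ENNReal.tsum_eq_zero] at h0
  -- If `(C i)* Ω = 0`, then `C i Ω` is orthogonal to `N Ω`, yet lies in its closure. All `C i Ω`
  -- would vanish, contradicting `∑ ‖C i Ω‖² = ‖Ω‖² = 1`.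
  have hz : ∀ i, C i Ω = 0 := by
    intro i
    have h1 : star (C i) Ω = 0 := by simpa using h0 i
    have key : closure ((fun d : H →L[ℂ] H => d Ω) '' (N : Set (H →L[ℂ] H)))
        ⊆ {y | ⟪y, C i Ω⟫_ℂ = 0} := by
      refine closure_minimal ?_ (isClosed_eq (by fun_prop) (by fun_prop))
      rintro _ ⟨a, ha, rfl⟩
      change ⟪a Ω, C i Ω⟫_ℂ = 0
      rw [← inner_star_left, commute_apply (star_mem (hC.mem_commutant i)) ha, h1, map_zero,
        inner_zero_left]
    exact inner_self_eq_zero.1 (key (hC.apply_mem i Ω))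
  have h2 := hC.tsum_eq_of_mem (trace_vector_mem_L2 M Ω)
  simp only [hz, enorm_zero] at h2
  have h3 : Ω = 0 := by simpa using h2.symm
  have h4 := hM.norm_eq_one
  simp [h3] at h4

end Multiplicativity

/-! ### Transport of algebras and indices by unitaries -/

section Conjugation

variable {H : Type*} [NormedAddCommGroup H] [InnerProductSpace ℂ H] [CompleteSpace H]

theorem mem_vonNeumannMap_iff {φ : (H →L[ℂ] H) ≃⋆ₐ[ℂ] (H →L[ℂ] H)} {M : VonNeumannAlgebra H}
    {T : H →L[ℂ] H} : T ∈ vonNeumannMap φ M ↔ φ.symm T ∈ M := by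
  change (T ∈ φ '' (M : Set (H →L[ℂ] H))) ↔ _
  constructor
  · rintro ⟨R, hR, rfl⟩
    simpa using hR
  · intro h
    exact ⟨_, h, by simp⟩

theorem map_mem_vonNeumannMap {φ : (H →L[ℂ] H) ≃⋆ₐ[ℂ] (H →L[ℂ] H)} {M : VonNeumannAlgebra H}
    {T : H →L[ℂ] H} (hT : T ∈ M) : φ T ∈ vonNeumannMap φ M :=
  mem_vonNeumannMap_iff.2 (by simpa using hT)

theorem vonNeumannMap_mono {M N : VonNeumannAlgebra H} (h : N ≤ M)
    (φ : (H →L[ℂ] H) ≃⋆ₐ[ℂ] (H →L[ℂ] H)) : vonNeumannMap φ N ≤ vonNeumannMap φ M :=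
  fun _ hT => mem_vonNeumannMap_iff.2 (h (mem_vonNeumannMap_iff.1 hT))

theorem map_mem_commutant_vonNeumannMap {φ : (H →L[ℂ] H) ≃⋆ₐ[ℂ] (H →L[ℂ] H)}
    {M : VonNeumannAlgebra H} {T : H →L[ℂ] H} (hT : T ∈ M.commutant) :
    φ T ∈ (vonNeumannMap φ M).commutant := by
  rw [VonNeumannAlgebra.mem_commutant_iff] at hT ⊢
  intro g hg
  have := congrArg φ (hT _ (mem_vonNeumannMap_iff.1 hg))
  simpa using this

theorem IsFactor.vonNeumannMap {M : VonNeumannAlgebra H} (h : IsFactor M)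
    (φ : (H →L[ℂ] H) ≃⋆ₐ[ℂ] (H →L[ℂ] H)) : IsFactor (vonNeumannMap φ M) := by
  intro T hT hT'
  obtain ⟨c, hc⟩ := h (φ.symm T) (mem_vonNeumannMap_iff.1 hT) (by
    rw [VonNeumannAlgebra.mem_commutant_iff] at hT' ⊢
    intro g hg
    have := congrArg φ.symm (hT' _ (map_mem_vonNeumannMap (φ := φ) hg))
    simpa using this)
  refine ⟨c, ?_⟩
  have := congrArg φ hc
  simpa using this

variable {U : H ≃ₗᵢ[ℂ] H} {Ω : H} {M N : VonNeumannAlgebra H}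

theorem conjStarAlgEquiv_apply_apply (U : H ≃ₗᵢ[ℂ] H) (T : H →L[ℂ] H) (x : H) :
    U.conjStarAlgEquiv T x = U (T (U.symm x)) := rfl

theorem mem_L2_vonNeumannMap_iff (hU : U Ω = Ω) {x : H} :
    x ∈ L2 (vonNeumannMap U.conjStarAlgEquiv M) Ω ↔ U.symm x ∈ L2 M Ω := by
  have hU' : U.symm Ω = Ω := by rw [LinearIsometryEquiv.symm_apply_eq, hU]
  have e : (fun d : H →L[ℂ] H => d Ω) ''
      (vonNeumannMap U.conjStarAlgEquiv M : Set (H →L[ℂ] H))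
      = U '' ((fun d : H →L[ℂ] H => d Ω) '' (M : Set (H →L[ℂ] H))) := by
    change (fun d : H →L[ℂ] H => d Ω) '' (U.conjStarAlgEquiv '' (M : Set (H →L[ℂ] H))) = _
    rw [Set.image_image, Set.image_image]
    refine Set.image_congr fun T _ => ?_
    rw [conjStarAlgEquiv_apply_apply, hU']
  rw [mem_L2_iff, e]
  change x ∈ closure (U.toHomeomorph '' _) ↔ _
  rw [← U.toHomeomorph.image_closure, U.toHomeomorph.image_eq_preimage_symm]
  rfl

theorem starProjection_L2_vonNeumannMap (hU : U Ω = Ω) (x : H) :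
    L2proj (vonNeumannMap U.conjStarAlgEquiv M) Ω x = U (L2proj M Ω (U.symm x)) := by
  refine Submodule.eq_starProjection_of_mem_of_inner_eq_zero ?_ ?_
  · rw [mem_L2_vonNeumannMap_iff hU, LinearIsometryEquiv.symm_apply_apply]
    exact L2proj_apply_mem _ _ _
  · intro w hw
    rw [mem_L2_vonNeumannMap_iff hU] at hw
    have := Submodule.starProjection_inner_eq_zero (K := L2 M Ω) (U.symm x) _ hw
    rw [← U.symm.inner_map_map, map_sub, LinearIsometryEquiv.symm_apply_apply]
    exact this

/-- The index is invariant under unitaries that fix the trace vector. -/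
theorem jonesIndex_vonNeumannMap (hU : U Ω = Ω) (hM : IsTraceVector M Ω)
    (hM' : IsTraceVector (vonNeumannMap U.conjStarAlgEquiv M) Ω) (hle : N ≤ M)
    (h : jonesIndex Ω M N < ⊤) :
    jonesIndex Ω (vonNeumannMap U.conjStarAlgEquiv M) (vonNeumannMap U.conjStarAlgEquiv N)
      = jonesIndex Ω M N := by
  obtain ⟨C, hC⟩ := exists_frame_of_jonesIndex_lt_top hle h
  have hU' : U.symm Ω = Ω := by rw [LinearIsometryEquiv.symm_apply_eq, hU]
  have hC' : IsModuleFrame (vonNeumannMap U.conjStarAlgEquiv N) Ω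
      (L2 (vonNeumannMap U.conjStarAlgEquiv M) Ω) fun i => U.conjStarAlgEquiv (C i) :=
    { mem_commutant := fun i => map_mem_commutant_vonNeumannMap (hC.mem_commutant i)
      apply_mem := fun i x => by
        rw [mem_L2_vonNeumannMap_iff hU, conjStarAlgEquiv_apply_apply,
          LinearIsometryEquiv.symm_apply_apply]
        exact hC.apply_mem i _
      tsum_eq := fun x => by
        rw [starProjection_L2_vonNeumannMap hU, LinearIsometryEquiv.enorm_map, ← hC.tsum_eq]
        exact tsum_congr fun i => by
          rw [conjStarAlgEquiv_apply_apply, LinearIsometryEquiv.enorm_map] }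
  rw [hC'.jonesIndex_eq hM' (vonNeumannMap_mono hle _), hC.jonesIndex_eq hM hle]
  refine tsum_congr fun i => ?_
  rw [← map_star, conjStarAlgEquiv_apply_apply, hU', LinearIsometryEquiv.enorm_map]

end Conjugation

/-! ### Generated von Neumann algebras -/

section Generated

variable {H : Type*} [NormedAddCommGroup H] [InnerProductSpace ℂ H] [CompleteSpace H]

theorem mem_vonNeumannGenerated_iff {S : Set (H →L[ℂ] H)} {T : H →L[ℂ] H} :
    T ∈ vonNeumannGenerated S ↔ ∀ R : H →L[ℂ] H,
      (∀ g ∈ S, g * R = R * g ∧ star g * R = R * star g) → R * T = T * R := by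
  rw [vonNeumannGenerated, VonNeumannAlgebra.mem_commutant_iff]
  exact forall_congr' fun R => imp_congr_left (StarSubalgebra.mem_centralizer_iff ℂ)

theorem subset_vonNeumannGenerated (S : Set (H →L[ℂ] H)) :
    S ⊆ (vonNeumannGenerated S : Set (H →L[ℂ] H)) :=
  fun _ hT => mem_vonNeumannGenerated_iff.2 fun _ hR => (hR _ hT).1.symm

theorem vonNeumannGenerated_le {S : Set (H →L[ℂ] H)} {M : VonNeumannAlgebra H}
    (h : S ⊆ (M : Set (H →L[ℂ] H))) : vonNeumannGenerated S ≤ M := by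
  intro T hT
  rw [← M.commutant_commutant, VonNeumannAlgebra.mem_commutant_iff]
  intro R hR
  rw [VonNeumannAlgebra.mem_commutant_iff] at hR
  exact mem_vonNeumannGenerated_iff.1 hT R fun g hg => ⟨hR g (h hg), hR _ (star_mem (h hg))⟩

theorem mem_commutant_vonNeumannGenerated {S : Set (H →L[ℂ] H)} {R : H →L[ℂ] H}
    (h : ∀ g ∈ S, g * R = R * g ∧ star g * R = R * star g) :
    R ∈ (vonNeumannGenerated S).commutant := by
  rw [VonNeumannAlgebra.mem_commutant_iff]
  exact fun T hT => (mem_vonNeumannGenerated_iff.1 hT R h).symm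

end Generated

/-! ### The trace vector of the GNS representation -/

section GNS

variable {A : Type*} [CStarAlgebra A] [PartialOrder A] [StarOrderedRing A] (τ : A →ₚ[ℂ] ℂ)

theorem gns_apply_gnsVector (a : A) :
    τ.gnsStarAlgHom a (gnsVector τ) = ((τ.toPreGNS a : τ.PreGNS) : τ.GNS) := by
  change τ.gnsNonUnitalStarAlgHom a ((τ.toPreGNS 1 : τ.PreGNS) : τ.GNS) = _
  rw [τ.gnsNonUnitalStarAlgHom_apply_coe]
  simp

theorem inner_gnsVector (a : A) :
    ⟪gnsVector τ, τ.gnsStarAlgHom a (gnsVector τ)⟫_ℂ = τ a := by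
  rw [gns_apply_gnsVector, gnsVector, UniformSpace.Completion.inner_coe, τ.preGNS_inner_def]
  simp

theorem dense_gns : Dense ((fun d : τ.GNS →L[ℂ] τ.GNS => d (gnsVector τ)) ''
    (τ.gnsStarAlgHom.range : Set (τ.GNS →L[ℂ] τ.GNS))) := by
  refine UniformSpace.Completion.denseRange_coe.mono ?_
  rintro _ ⟨x, rfl⟩
  exact ⟨τ.gnsStarAlgHom (τ.ofPreGNS x), ⟨_, rfl⟩, gns_apply_gnsVector τ _⟩

variable {τ}

theorem IsTracialState.inner_gns (hτ : IsTracialState τ) :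
    ∀ a ∈ τ.gnsStarAlgHom.range, ∀ b ∈ τ.gnsStarAlgHom.range,
      ⟪gnsVector τ, (a * b) (gnsVector τ)⟫_ℂ = ⟪gnsVector τ, (b * a) (gnsVector τ)⟫_ℂ := by
  rintro _ ⟨a, rfl⟩ _ ⟨b, rfl⟩
  change ⟪gnsVector τ, (τ.gnsStarAlgHom a * τ.gnsStarAlgHom b) (gnsVector τ)⟫_ℂ
    = ⟪gnsVector τ, (τ.gnsStarAlgHom b * τ.gnsStarAlgHom a) (gnsVector τ)⟫_ℂ
  rw [← map_mul, ← map_mul, inner_gnsVector, inner_gnsVector, hτ.map_mul_comm]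

/-- Right multiplication by `b` on `L²(A, τ)`. -/
theorem IsTracialState.exists_rightMul (hτ : IsTracialState τ) (b : A) :
    ∃ R : τ.GNS →L[ℂ] τ.GNS, (∀ a, τ.gnsStarAlgHom a * R = R * τ.gnsStarAlgHom a) ∧
      R (gnsVector τ) = τ.gnsStarAlgHom b (gnsVector τ) := by
  have hstar : ∀ a : A, ‖τ.gnsStarAlgHom (star a) (gnsVector τ)‖
      = ‖τ.gnsStarAlgHom a (gnsVector τ)‖ := by
    intro a
    rw [map_star]
    exact norm_star_apply_eq_of_trace (hτ.inner_gns _ ⟨star a, map_star τ.gnsStarAlgHom a⟩ _ ⟨a, rfl⟩)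
  let e : A →ₗ[ℂ] τ.GNS :=
    (ContinuousLinearMap.apply ℂ τ.GNS (gnsVector τ)).toLinearMap ∘ₗ
      τ.gnsStarAlgHom.toAlgHom.toLinearMap
  let f : A →ₗ[ℂ] τ.GNS := e ∘ₗ LinearMap.mulRight ℂ b
  have he : ∀ a, e a = τ.gnsStarAlgHom a (gnsVector τ) := fun a => rfl
  have hf : ∀ a, f a = e (a * b) := fun a => rfl
  have hdense : DenseRange e := by
    refine (dense_gns τ).mono ?_
    rintro _ ⟨_, ⟨a, rfl⟩, rfl⟩
    exact ⟨a, rfl⟩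
  -- The trace property turns right multiplication into left multiplication: `‖a b Ω‖ = ‖b* a* Ω‖ ≤
  -- ‖b*‖ ‖a* Ω‖ = ‖b*‖ ‖a Ω‖`.
  have hbound : ∀ a, ‖f a‖ ≤ ‖τ.gnsStarAlgHom (star b)‖ * ‖e a‖ := by
    intro a
    rw [hf, he, he, ← hstar, star_mul, map_mul, ← hstar a]
    exact (τ.gnsStarAlgHom (star b)).le_opNorm _
  have hR : ∀ a, f.extendOfNorm e (e a) = e (a * b) := fun a =>
    LinearMap.extendOfNorm_eq hdense ⟨_, hbound⟩ a
  refine ⟨f.extendOfNorm e, fun a => ?_, ?_⟩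
  · refine ContinuousLinearMap.ext fun x => ?_
    refine congrFun (hdense.equalizer (τ.gnsStarAlgHom a * f.extendOfNorm e).continuous
      (f.extendOfNorm e * τ.gnsStarAlgHom a).continuous (funext fun c => ?_)) x
    change τ.gnsStarAlgHom a (f.extendOfNorm e (e c)) = f.extendOfNorm e (τ.gnsStarAlgHom a (e c))
    have h1 : ∀ c, τ.gnsStarAlgHom a (e c) = e (a * c) := fun c => by
      rw [he, he, map_mul]; rfl
    rw [hR, h1, h1, hR, mul_assoc]
  · have h1 : gnsVector τ = e 1 := by rw [he, _root_.map_one]; rfl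
    conv_lhs => rw [h1]
    rw [hR, one_mul, he]

theorem IsTracialState.norm_gnsVector (hτ : IsTracialState τ) : ‖gnsVector τ‖ = 1 := by
  rw [gnsVector, UniformSpace.Completion.norm_coe, τ.preGNS_norm_def]
  simp [hτ.map_one]

/-- The vector of the trace is a trace vector of the von Neumann algebra `A''`. -/
theorem IsTracialState.isTraceVector (hτ : IsTracialState τ) :
    IsTraceVector (vonNeumannGenerated (Set.range τ.gnsStarAlgHom)) (gnsVector τ) := by
  set M := vonNeumannGenerated (Set.range τ.gnsStarAlgHom) with hM
  have hcomm : ∀ T ∈ M.commutant, ∀ d ∈ τ.gnsStarAlgHom.range, d * T = T * d := by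
    rintro T hT _ ⟨a, rfl⟩
    exact VonNeumannAlgebra.mem_commutant_iff.1 hT _ (subset_vonNeumannGenerated _ ⟨a, rfl⟩)
  have htr : ∀ a ∈ M.commutant, ∀ b ∈ M.commutant,
      ⟪gnsVector τ, (a * b) (gnsVector τ)⟫_ℂ = ⟪gnsVector τ, (b * a) (gnsVector τ)⟫_ℂ :=
    fun a ha b hb => trace_of_commute τ.gnsStarAlgHom.range hτ.inner_gns (hcomm a ha) (hcomm b hb)
      (dense_gns τ _) (dense_gns τ _) (dense_gns τ _) (dense_gns τ _)
  -- Right multiplications lie in the commutant and already reach every `b Ω`.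
  have hdense : Dense ((fun d : τ.GNS →L[ℂ] τ.GNS => d (gnsVector τ)) ''
      (M.commutant : Set (τ.GNS →L[ℂ] τ.GNS))) := by
    refine (dense_gns τ).mono ?_
    rintro _ ⟨_, ⟨b, rfl⟩, rfl⟩
    obtain ⟨R, hR, hRΩ⟩ := hτ.exists_rightMul b
    refine ⟨R, mem_commutant_vonNeumannGenerated ?_, hRΩ⟩
    rintro _ ⟨a, rfl⟩
    refine ⟨hR a, ?_⟩
    rw [← map_star]
    exact hR (star a)
  refine ⟨hτ.norm_gnsVector, fun a ha b hb => ?_, hdense⟩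
  -- `trace_of_commute` is used twice: it carries the trace property from the image of `A` to the
  -- commutant, and from there to `A''`.
  refine trace_of_commute M.commutant.toStarSubalgebra htr (fun d hd => ?_) (fun d hd => ?_)
    (hdense _) (hdense _) (hdense _) (hdense _)
  · exact (VonNeumannAlgebra.mem_commutant_iff.1 hd a ha).symm
  · exact (VonNeumannAlgebra.mem_commutant_iff.1 hd b hb).symm

theorem gnsUnitary_coe (hτ : IsUniqueTracialState τ) (α : A ≃⋆ₐ[ℂ] A) (a : A) :
    gnsUnitary τ hτ α ((τ.toPreGNS a : τ.PreGNS) : τ.GNS)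
      = ((τ.toPreGNS (α a) : τ.PreGNS) : τ.GNS) := by
  change (preGNSIsometry τ α (hτ.map_apply α)).toContinuousLinearMap.completion _ = _
  simp [preGNSIsometry]

theorem gnsUnitary_gnsVector (hτ : IsUniqueTracialState τ) (α : A ≃⋆ₐ[ℂ] A) :
    gnsUnitary τ hτ α (gnsVector τ) = gnsVector τ := by
  rw [gnsVector, gnsUnitary_coe, map_one]

theorem gnsUnitary_mul (hτ : IsUniqueTracialState τ) (α β : A ≃⋆ₐ[ℂ] A) (x : τ.GNS) :
    gnsUnitary τ hτ (α * β) x = gnsUnitary τ hτ α (gnsUnitary τ hτ β x) := by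
  induction x using UniformSpace.Completion.induction_on with
  | hp =>
    exact isClosed_eq (gnsUnitary τ hτ _).continuous
      ((gnsUnitary τ hτ _).continuous.comp (gnsUnitary τ hτ _).continuous)
  | ih a =>
    obtain ⟨a, rfl⟩ := τ.toPreGNS.surjective a
    rw [gnsUnitary_coe, gnsUnitary_coe, gnsUnitary_coe]
    rfl

theorem extend_mul (hτ : IsUniqueTracialState τ) (α β : A ≃⋆ₐ[ℂ] A)
    (T : τ.GNS →L[ℂ] τ.GNS) :
    extend τ hτ (α * β) T = extend τ hτ α (extend τ hτ β T) := by
  ext x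
  obtain ⟨y, rfl⟩ := (gnsUnitary τ hτ (α * β)).surjective x
  change gnsUnitary τ hτ (α * β) (T ((gnsUnitary τ hτ (α * β)).symm _))
    = gnsUnitary τ hτ α (gnsUnitary τ hτ β (T ((gnsUnitary τ hτ β).symm
      ((gnsUnitary τ hτ α).symm _))))
  rw [LinearIsometryEquiv.symm_apply_apply, gnsUnitary_mul, gnsUnitary_mul,
    LinearIsometryEquiv.symm_apply_apply, LinearIsometryEquiv.symm_apply_apply]

theorem vonNeumannMap_extend_mul (hτ : IsUniqueTracialState τ) (α β : A ≃⋆ₐ[ℂ] A)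
    (M : VonNeumannAlgebra τ.GNS) :
    vonNeumannMap (extend τ hτ (α * β)) M
      = vonNeumannMap (extend τ hτ α) (vonNeumannMap (extend τ hτ β) M) := by
  refine SetLike.coe_injective ?_
  change extend τ hτ (α * β) '' (M : Set (τ.GNS →L[ℂ] τ.GNS))
    = extend τ hτ α '' (extend τ hτ β '' (M : Set (τ.GNS →L[ℂ] τ.GNS)))
  rw [Set.image_image]
  exact Set.image_congr fun T _ => extend_mul hτ α β T

end GNS

namespace SpinChain

/-! ### Spread and cuts of depth one circuits -/

section Circuits

variable {A : Type*} [CStarAlgebra A] {S : SpinChain A}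

theorem partialProduct_conj_succ {I : ℕ → NonemptyInterval ℤ} {u : ℕ → A}
    (h : S.IsCircuitLayer I u) (n : ℕ) (w : A) :
    partialProduct u (n + 1) * w * star (partialProduct u (n + 1))
      = u n * (partialProduct u n * w * star (partialProduct u n)) * star (u n) := by
  rw [partialProduct_succ, ← (h.commute_partialProduct le_rfl).eq, star_mul]
  simp only [mul_assoc]

theorem unitary_conj_of_commute {u w : A} (hu : u ∈ unitary A) (h : Commute u w) :
    u * w * star u = w := by
  rw [h.eq, mul_assoc, Unitary.mul_star_self_of_mem hu, mul_one]

/-- A circuit layer conjugates `A_J` into the algebra of an interval that is only enlarged by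
the intervals of the layer that meet `J`. -/
theorem IsCircuitLayer.conj_mem_enlarge {I : ℕ → NonemptyInterval ℤ} {u : ℕ → A}
    (h : S.IsCircuitLayer I u) {l : ℕ} (hl : ∀ i, (I i).snd - (I i).fst ≤ l)
    {J : NonemptyInterval ℤ} {w : A} (hw : w ∈ S.alg J) (n : ℕ) :
    partialProduct u n * w * Star.star (partialProduct u n) ∈ S.alg (enlarge J l) := by
  have hJ : J ≤ enlarge J l :=
    ⟨show J.fst - l ≤ J.fst by omega, show J.snd ≤ J.snd + l by omega⟩
  induction n with
  | zero => simpa [partialProduct] using S.alg.monotone hJ hw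
  | succ n ih =>
    rw [partialProduct_conj_succ h]
    -- If `I n` misses `J`, then `u n` commutes with `w` and with the earlier unitaries and has no
    -- effect. Otherwise `I n` meets `J`, and its length bound keeps it inside the enlargement by
    -- `l`, so the enlargement does not grow with `n`.
    by_cases hd : Disjoint (I n : Set ℤ) (J : Set ℤ)
    · have h1 := h.commute_partialProduct (le_refl n)
      have h2 : Commute (u n) w := S.locality _ _ hd _ (h.mem n) _ hw
      have h3 : Commute (u n) (Star.star (partialProduct u n)) := by
        rw [← h.partialProduct_star]
        have : ∀ m ≤ n, Commute (u n) (partialProduct (fun i => Star.star (u i)) m) := by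
          intro m
          induction m with
          | zero => intro _; simp [partialProduct]
          | succ m ihm =>
            intro hm
            rw [partialProduct_succ]
            exact (ihm (by omega)).mul_right (S.locality _ _ (h.disjoint n m (by omega)) _
              (h.mem n) _ (star_mem (h.mem m)))
        exact this n le_rfl
      rw [unitary_conj_of_commute (h.unitary n) ((h1.mul_right h2).mul_right h3)]
      exact ih
    · obtain ⟨k, hk, hkJ⟩ := Set.not_disjoint_iff.1 hd
      have hle : I n ≤ enlarge J l := by
        have h1 := hl n
        obtain ⟨h2, h3⟩ : (I n).fst ≤ k ∧ k ≤ (I n).snd := hk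
        obtain ⟨h4, h5⟩ : J.fst ≤ k ∧ k ≤ J.snd := hkJ
        exact ⟨show J.fst - l ≤ (I n).fst by omega, show (I n).snd ≤ J.snd + l by omega⟩
      have hu := S.alg.monotone hle (h.mem n)
      exact mul_mem (mul_mem hu ih) (star_mem hu)

theorem IsDepthOneCircuit.exists_forall_mem_enlarge {α : A ≃⋆ₐ[ℂ] A}
    (hα : S.IsDepthOneCircuit α) :
    ∃ l : ℕ, ∀ J : NonemptyInterval ℤ, ∀ w ∈ S.alg J, α w ∈ S.alg (enlarge J l) := by
  obtain ⟨I, u, h, hconj⟩ := hα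
  obtain ⟨l, hl⟩ := h.bounded
  refine ⟨l, fun J w hw => ?_⟩
  obtain ⟨n, hn⟩ := (hconj J w hw).exists
  rw [hn]
  exact h.conj_mem_enlarge hl hw n

theorem enlarge_mono (J : NonemptyInterval ℤ) {l m : ℕ} (h : l ≤ m) : enlarge J l ≤ enlarge J m :=
  ⟨show J.fst - m ≤ J.fst - l by omega, show J.snd + l ≤ J.snd + m by omega⟩

theorem IsDepthOneCircuit.mem_QCA {α : A ≃⋆ₐ[ℂ] A} (hα : S.IsDepthOneCircuit α) : α ∈ S.QCA := by
  obtain ⟨l, hl⟩ := hα.exists_forall_mem_enlarge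
  obtain ⟨m, hm⟩ := hα.inv.exists_forall_mem_enlarge
  exact ⟨max l m, fun J w hw => ⟨S.alg.monotone (enlarge_mono J (le_max_left _ _)) (hl J w hw),
    S.alg.monotone (enlarge_mono J (le_max_right _ _)) (hm J w hw)⟩⟩

/-- A depth one circuit preserves the operators on the left of a cut between two of its
intervals. -/
theorem IsDepthOneCircuit.exists_cut {α : A ≃⋆ₐ[ℂ] A} (hα : S.IsDepthOneCircuit α) :
    ∃ x : ℤ, ∀ J : NonemptyInterval ℤ, J.snd ≤ x → ∀ w ∈ S.alg J,
      ∃ J' : NonemptyInterval ℤ, J'.snd ≤ x ∧ α w ∈ S.alg J' := by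
  obtain ⟨I, u, h, hconj⟩ := hα
  -- The right end of any interval of the partition is a cut: every other interval lies entirely on
  -- one side of it.
  refine ⟨(I 0).snd, fun J hJ w hw => ?_⟩
  obtain ⟨n, hn⟩ := (hconj J w hw).exists
  rw [hn]
  clear hn
  induction n with
  | zero => exact ⟨J, hJ, by simpa [partialProduct] using hw⟩
  | succ n ih =>
    obtain ⟨J', hJ', hmem⟩ := ih
    rw [partialProduct_conj_succ h]
    by_cases hle : (I n).snd ≤ (I 0).snd
    · refine ⟨J' ⊔ I n, sup_le hJ' hle, ?_⟩
      have hu := S.alg.monotone (le_sup_right : I n ≤ J' ⊔ I n) (h.mem n)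
      exact mul_mem (mul_mem hu (S.alg.monotone (le_sup_left : J' ≤ J' ⊔ I n) hmem)) (star_mem hu)
    · refine ⟨J', hJ', ?_⟩
      have hfst : (I 0).snd < (I n).fst := by
        by_contra hcon
        have hn0 : n ≠ 0 := by rintro rfl; exact hle le_rfl
        have h1 : (I 0).snd ∈ (I n : Set ℤ) := ⟨not_lt.1 hcon, (not_le.1 hle).le⟩
        exact Set.disjoint_left.1 (h.disjoint n 0 hn0) h1 ⟨(I 0).fst_le_snd, le_rfl⟩
      rw [unitary_conj_of_commute (h.unitary n)]
      · exact hmem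
      · refine S.locality _ _ (Set.disjoint_left.2 fun k hk hk' => ?_) _ (h.mem n) _ hmem
        obtain ⟨h2, -⟩ : (I n).fst ≤ k ∧ k ≤ (I n).snd := hk
        obtain ⟨-, h5⟩ : J'.fst ≤ k ∧ k ≤ J'.snd := hk'
        omega

end Circuits

/-! ### The algebras `𝒜 x`, their images under QCAs, and the index ratio -/

section LeftAlgebras

variable {A : Type*} [CStarAlgebra A] [PartialOrder A] [StarOrderedRing A] {S : SpinChain A}
  {τ : A →ₚ[ℂ] ℂ}

theorem gns_mem_leftAlgebra {I : NonemptyInterval ℤ} {x : ℤ} (hI : I.snd ≤ x) {a : A}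
    (ha : a ∈ S.alg I) : τ.gnsStarAlgHom a ∈ S.leftAlgebra τ x :=
  subset_vonNeumannGenerated _ (Set.mem_iUnion₂.2 ⟨I, hI, a, ha, rfl⟩)

theorem leftAlgebra_le {x : ℤ} {M : VonNeumannAlgebra τ.GNS}
    (h : ∀ I : NonemptyInterval ℤ, I.snd ≤ x → ∀ a ∈ S.alg I, τ.gnsStarAlgHom a ∈ M) :
    S.leftAlgebra τ x ≤ M := by
  refine vonNeumannGenerated_le fun T hT => ?_
  obtain ⟨I, hI, a, ha, rfl⟩ := Set.mem_iUnion₂.1 hT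
  exact h I hI a ha

theorem leftAlgebra_mono {x z : ℤ} (h : x ≤ z) : S.leftAlgebra τ x ≤ S.leftAlgebra τ z :=
  leftAlgebra_le fun _ hI _ ha => gns_mem_leftAlgebra (hI.trans h) ha

theorem isTraceVector_leftAlgebra (hτ : IsUniqueTracialState τ) (x : ℤ) :
    IsTraceVector (S.leftAlgebra τ x) (gnsVector τ) :=
  hτ.toIsTracialState.isTraceVector.mono
    (leftAlgebra_le fun _ _ a _ => subset_vonNeumannGenerated _ ⟨a, rfl⟩)

theorem imageLeftAlgebra_le (hτ : IsUniqueTracialState τ) {α : A ≃⋆ₐ[ℂ] A} {x : ℤ} {M : VonNeumannAlgebra τ.GNS}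
    (h : ∀ I : NonemptyInterval ℤ, I.snd ≤ x → ∀ a ∈ S.alg I, τ.gnsStarAlgHom (α a) ∈ M) :
    S.imageLeftAlgebra τ hτ α x ≤ M := by
  have h1 : S.leftAlgebra τ x ≤ vonNeumannMap (extend τ hτ α).symm M := by
    refine leftAlgebra_le fun I hI a ha => mem_vonNeumannMap_iff.2 ?_
    change extend τ hτ α (τ.gnsStarAlgHom a) ∈ M
    rw [extend_gns]
    exact h I hI a ha
  intro T hT
  have h2 := mem_vonNeumannMap_iff.1 (h1 (mem_vonNeumannMap_iff.1 hT))
  change extend τ hτ α ((extend τ hτ α).symm T) ∈ M at h2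
  rwa [StarAlgEquiv.apply_symm_apply] at h2

/-- Writing `a = α (α⁻¹ a)`, this is the bound on the spread of `α⁻¹`. -/
theorem leftAlgebra_le_imageLeftAlgebra (hτ : IsUniqueTracialState τ) {α : A ≃⋆ₐ[ℂ] A} {l : ℕ} (hα : S.HasSpread α l) (x : ℤ) :
    S.leftAlgebra τ (x - l) ≤ S.imageLeftAlgebra τ hτ α x := by
  refine leftAlgebra_le fun I hI a ha => ?_
  have h1 : a = α (α⁻¹ a) := (α.apply_symm_apply a).symm
  rw [h1, ← extend_gns τ hτ]
  refine map_mem_vonNeumannMap (gns_mem_leftAlgebra (I := enlarge I l) ?_ (hα I a ha).2)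
  change I.snd + l ≤ x
  omega

theorem imageLeftAlgebra_le_leftAlgebra (hτ : IsUniqueTracialState τ) {α : A ≃⋆ₐ[ℂ] A} {l : ℕ} (hα : S.HasSpread α l) (x : ℤ) :
    S.imageLeftAlgebra τ hτ α x ≤ S.leftAlgebra τ (x + l) :=
  imageLeftAlgebra_le hτ fun I hI a ha =>
    gns_mem_leftAlgebra (I := enlarge I l) (show I.snd + l ≤ x + l by omega) (hα I a ha).1

theorem isTraceVector_vonNeumannMap_imageLeftAlgebra (hτ : IsUniqueTracialState τ) (α β : A ≃⋆ₐ[ℂ] A) (x : ℤ) :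
    IsTraceVector (vonNeumannMap (extend τ hτ α) (S.imageLeftAlgebra τ hτ β x))
      (gnsVector τ) := by
  refine hτ.toIsTracialState.isTraceVector.mono ?_
  rw [imageLeftAlgebra, ← vonNeumannMap_extend_mul]
  exact imageLeftAlgebra_le hτ fun _ _ _ _ => subset_vonNeumannGenerated _ ⟨_, rfl⟩

theorem isTraceVector_imageLeftAlgebra (hτ : IsUniqueTracialState τ) (α : A ≃⋆ₐ[ℂ] A) (x : ℤ) :
    IsTraceVector (S.imageLeftAlgebra τ hτ α x) (gnsVector τ) :=
  hτ.toIsTracialState.isTraceVector.mono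
    (imageLeftAlgebra_le hτ fun _ _ _ _ => subset_vonNeumannGenerated _ ⟨_, rfl⟩)

theorem jonesIndex_leftAlgebra_lt_top (hτ : IsUniqueTracialState τ)
    (hS : S.FiniteIndexProperty τ) {x y : ℤ} (h : y ≤ x) :
    jonesIndex (gnsVector τ) (S.leftAlgebra τ x) (S.leftAlgebra τ y) < ⊤ := by
  rcases h.eq_or_lt with rfl | h
  · rw [jonesIndex_self (isTraceVector_leftAlgebra hτ _)]
    exact ENNReal.one_lt_top
  · exact hS.finite_index _ _ h

/-- `α (𝒜 x)` is contained in `𝒜 (x + l)`, which has finite index over `𝒜 y`. -/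
theorem jonesIndex_imageLeftAlgebra_lt_top (hτ : IsUniqueTracialState τ)
    (hS : S.FiniteIndexProperty τ) {α : A ≃⋆ₐ[ℂ] A} (hα : α ∈ S.QCA) {x y : ℤ}
    (hyx : y ≤ x) (h : S.leftAlgebra τ y ≤ S.imageLeftAlgebra τ hτ α x) :
    jonesIndex (gnsVector τ) (S.imageLeftAlgebra τ hτ α x) (S.leftAlgebra τ y) < ⊤ := by
  obtain ⟨l, hl⟩ := hα
  exact (jonesIndex_mono (isTraceVector_leftAlgebra hτ _) h
    (imageLeftAlgebra_le_leftAlgebra hτ hl x)).trans_lt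
    (jonesIndex_leftAlgebra_lt_top hτ hS (by omega))

theorem indexRatio_pos (hτ : IsUniqueTracialState τ)
    (hS : S.FiniteIndexProperty τ) {α : A ≃⋆ₐ[ℂ] A} (hα : α ∈ S.QCA) {x y : ℤ}
    (hyx : y ≤ x) (h : S.leftAlgebra τ y ≤ S.imageLeftAlgebra τ hτ α x) :
    0 < S.indexRatio τ hτ α x y := by
  have h1 := jonesIndex_imageLeftAlgebra_lt_top hτ hS hα hyx h
  have h2 := jonesIndex_leftAlgebra_lt_top hτ hS hyx
  exact Real.sqrt_pos.2 (div_pos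
    (ENNReal.toReal_pos (jonesIndex_pos (isTraceVector_imageLeftAlgebra hτ α x) h h1) h1.ne)
    (ENNReal.toReal_pos (jonesIndex_pos (isTraceVector_leftAlgebra hτ x) (leftAlgebra_mono hyx) h2)
      h2.ne))

theorem toReal_jonesIndex_leftAlgebra_pos (hτ : IsUniqueTracialState τ)
    (hS : S.FiniteIndexProperty τ) {x y : ℤ} (h : y ≤ x) :
    0 < (jonesIndex (gnsVector τ) (S.leftAlgebra τ x) (S.leftAlgebra τ y)).toReal :=
  have h2 := jonesIndex_leftAlgebra_lt_top hτ hS h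
  ENNReal.toReal_pos (jonesIndex_pos (isTraceVector_leftAlgebra hτ x) (leftAlgebra_mono h) h2) h2.ne

theorem jonesIndex_leftAlgebra_mul (hτ : IsUniqueTracialState τ)
    (hS : S.FiniteIndexProperty τ) {x y z : ℤ} (hxy : x ≤ y) (hyz : y ≤ z) :
    jonesIndex (gnsVector τ) (S.leftAlgebra τ z) (S.leftAlgebra τ x)
      = jonesIndex (gnsVector τ) (S.leftAlgebra τ z) (S.leftAlgebra τ y)
        * jonesIndex (gnsVector τ) (S.leftAlgebra τ y) (S.leftAlgebra τ x) :=
  jonesIndex_mul (isTraceVector_leftAlgebra hτ z) (hS.isFactor y) (leftAlgebra_mono hxy)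
    (leftAlgebra_mono hyz) (jonesIndex_leftAlgebra_lt_top hτ hS hyz)
    (jonesIndex_leftAlgebra_lt_top hτ hS hxy)

/-- The tower `αβ(𝒜_x) ⊇ α(𝒜_z) ⊇ 𝒜_y`, whose upper step is the image under `α` of `β(𝒜_x) ⊇ 𝒜_z`.
-/
theorem jonesIndex_imageLeftAlgebra_mul (hτ : IsUniqueTracialState τ)
    (hS : S.FiniteIndexProperty τ) {α β : A ≃⋆ₐ[ℂ] A} (hα : α ∈ S.QCA) (hβ : β ∈ S.QCA)
    {x y z : ℤ} (hyz : y ≤ z) (hzx : z ≤ x)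
    (h₁ : S.leftAlgebra τ y ≤ S.imageLeftAlgebra τ hτ α z)
    (h₂ : S.leftAlgebra τ z ≤ S.imageLeftAlgebra τ hτ β x) :
    jonesIndex (gnsVector τ) (S.imageLeftAlgebra τ hτ (α * β) x) (S.leftAlgebra τ y)
      = jonesIndex (gnsVector τ) (S.imageLeftAlgebra τ hτ β x) (S.leftAlgebra τ z)
        * jonesIndex (gnsVector τ) (S.imageLeftAlgebra τ hτ α z) (S.leftAlgebra τ y) := by
  have hfin := jonesIndex_imageLeftAlgebra_lt_top hτ hS hβ hzx h₂
  have htv := isTraceVector_vonNeumannMap_imageLeftAlgebra (S := S) hτ α β x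
  have hconj : jonesIndex (gnsVector τ)
      (vonNeumannMap (extend τ hτ α) (S.imageLeftAlgebra τ hτ β x)) (S.imageLeftAlgebra τ hτ α z)
      = jonesIndex (gnsVector τ) (S.imageLeftAlgebra τ hτ β x) (S.leftAlgebra τ z) :=
    jonesIndex_vonNeumannMap (gnsUnitary_gnsVector hτ α) (isTraceVector_imageLeftAlgebra hτ β x)
      htv h₂ hfin
  have himage : S.imageLeftAlgebra τ hτ (α * β) x
      = vonNeumannMap (extend τ hτ α) (S.imageLeftAlgebra τ hτ β x) :=
    vonNeumannMap_extend_mul hτ α β _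
  rw [himage, ← hconj]
  exact jonesIndex_mul htv ((hS.isFactor z).vonNeumannMap _) h₁ (vonNeumannMap_mono h₂ _)
    (by rw [hconj]; exact hfin) (jonesIndex_imageLeftAlgebra_lt_top hτ hS hα hyz h₁)

theorem indexRatio_mul (hτ : IsUniqueTracialState τ)
    (hS : S.FiniteIndexProperty τ) {α β : A ≃⋆ₐ[ℂ] A} (hα : α ∈ S.QCA) (hβ : β ∈ S.QCA)
    {x y z : ℤ} (hyz : y ≤ z) (hzx : z ≤ x)
    (h₁ : S.leftAlgebra τ y ≤ S.imageLeftAlgebra τ hτ α z)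
    (h₂ : S.leftAlgebra τ z ≤ S.imageLeftAlgebra τ hτ β x) :
    S.indexRatio τ hτ (α * β) x y = S.indexRatio τ hτ α z y * S.indexRatio τ hτ β x z := by
  rw [indexRatio, indexRatio, indexRatio, ← Real.sqrt_mul (by positivity),
    jonesIndex_imageLeftAlgebra_mul hτ hS hα hβ hyz hzx h₁ h₂,
    jonesIndex_leftAlgebra_mul hτ hS hyz hzx, ENNReal.toReal_mul, ENNReal.toReal_mul,
    div_mul_div_comm]
  congr 1
  rw [mul_comm (ENNReal.toReal _) (ENNReal.toReal (jonesIndex _ (imageLeftAlgebra ..) _))]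
  congr 1
  exact mul_comm _ _

theorem imageLeftAlgebra_one (hτ : IsUniqueTracialState τ) (x : ℤ) :
    S.imageLeftAlgebra τ hτ 1 x = S.leftAlgebra τ x := by
  refine le_antisymm (imageLeftAlgebra_le hτ fun I hI a ha => gns_mem_leftAlgebra hI ha) ?_
  have h := leftAlgebra_le_imageLeftAlgebra (S := S) hτ (α := 1) (l := 0) (fun I a ha => ?_) x
  · simpa using h
  · have : enlarge I 0 = I := by
      apply NonemptyInterval.ext; simp [enlarge]
    rw [this]
    exact ⟨ha, by simpa using ha⟩

theorem indexRatio_one (hτ : IsUniqueTracialState τ)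
    (hS : S.FiniteIndexProperty τ) {x y : ℤ} (h : y ≤ x) : S.indexRatio τ hτ 1 x y = 1 := by
  rw [indexRatio, imageLeftAlgebra_one hτ,
    div_self (toReal_jonesIndex_leftAlgebra_pos hτ hS h).ne', Real.sqrt_one]

/-- The ratio does not change if `x` grows and `y` decreases. -/
theorem indexRatio_eq_of_le (hτ : IsUniqueTracialState τ)
    (hS : S.FiniteIndexProperty τ) {α : A ≃⋆ₐ[ℂ] A} (hα : α ∈ S.QCA) {x y x' y' : ℤ} (hyx : y ≤ x)
    (h : S.leftAlgebra τ y ≤ S.imageLeftAlgebra τ hτ α x) (hx : x ≤ x') (hy : y' ≤ y) :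
    S.indexRatio τ hτ α x' y' = S.indexRatio τ hτ α x y := by
  have hone : ∀ z, S.leftAlgebra τ z ≤ S.imageLeftAlgebra τ hτ 1 z := fun z =>
    (imageLeftAlgebra_one hτ z).ge
  -- Writing `α = α * 1` moves `x` to `x'`, and writing `α = 1 * α` moves `y` to `y'`; the identity
  -- contributes the ratio `1`.
  have h1 := indexRatio_mul hτ hS hα S.QCA.one_mem (hy.trans hyx) hx
    ((leftAlgebra_mono hy).trans h) ((leftAlgebra_mono hx).trans (hone x'))
  have h2 := indexRatio_mul hτ hS S.QCA.one_mem hα hy hyx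
    ((leftAlgebra_mono hy).trans (hone y)) h
  rw [mul_one, indexRatio_one hτ hS hx, mul_one] at h1
  rw [one_mul, indexRatio_one hτ hS hy, one_mul] at h2
  rw [h1, h2]

theorem indexRatio_eq (hτ : IsUniqueTracialState τ)
    (hS : S.FiniteIndexProperty τ) {α : A ≃⋆ₐ[ℂ] A} (hα : α ∈ S.QCA) {x y x' y' : ℤ} (hyx : y ≤ x)
    (h : S.leftAlgebra τ y ≤ S.imageLeftAlgebra τ hτ α x) (hyx' : y' ≤ x')
    (h' : S.leftAlgebra τ y' ≤ S.imageLeftAlgebra τ hτ α x') :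
    S.indexRatio τ hτ α x y = S.indexRatio τ hτ α x' y' := by
  -- Both pairs are compared with the pair `(max x x', min y y')`.
  rw [← indexRatio_eq_of_le hτ hS hα hyx h (le_max_left x x') (min_le_left y y'),
    indexRatio_eq_of_le hτ hS hα hyx' h' (le_max_right x x') (min_le_right y y')]

theorem exists_leftAlgebra_le_imageLeftAlgebra (hτ : IsUniqueTracialState τ) {α : A ≃⋆ₐ[ℂ] A} (hα : α ∈ S.QCA) (x : ℤ) :
    ∃ y ≤ x, S.leftAlgebra τ y ≤ S.imageLeftAlgebra τ hτ α x := by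
  obtain ⟨l, hl⟩ := hα
  exact ⟨x - l, by omega, leftAlgebra_le_imageLeftAlgebra hτ hl x⟩

/-- One inclusion is enough for circuits: the reverse inequality comes from the inverse circuit. -/
theorem indexRatio_le_one (hτ : IsUniqueTracialState τ)
    (hS : S.FiniteIndexProperty τ) {α : A ≃⋆ₐ[ℂ] A} {x y : ℤ} (hyx : y ≤ x)
    (h : S.leftAlgebra τ y ≤ S.imageLeftAlgebra τ hτ α x)
    (hle : S.imageLeftAlgebra τ hτ α x ≤ S.leftAlgebra τ x) :
    S.indexRatio τ hτ α x y ≤ 1 := by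
  rw [indexRatio, Real.sqrt_le_one, div_le_one (toReal_jonesIndex_leftAlgebra_pos hτ hS hyx)]
  exact ENNReal.toReal_mono (jonesIndex_leftAlgebra_lt_top hτ hS hyx).ne
    (jonesIndex_mono (isTraceVector_leftAlgebra hτ x) h hle)

end LeftAlgebras

end SpinChain

end QCAIndex

end

/-- For a spin chain with a unique tracial state and the left finite index property: for every
QCA `α` and every `x` there is an admissible `y`, both indices are finite for all admissible
pairs `(x, y)`, and the ratio is independent of the pair and defines a group homomorphism
into the positive reals whose kernel contains the finite depth circuits. -/
theorem theoremA {A : Type*} [CStarAlgebra A] [PartialOrder A] [StarOrderedRing A]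
    (S : QCAIndex.SpinChain A) (τ : A →ₚ[ℂ] ℂ) (hτ : QCAIndex.IsUniqueTracialState τ)
    (hS : S.FiniteIndexProperty τ) :
    (∀ (α : S.QCA) (x : ℤ), ∃ y ≤ x, S.leftAlgebra τ y ≤ S.imageLeftAlgebra τ hτ α x) ∧
    ∃ ind : S.QCA →* {r : ℝ // 0 < r},
      (∀ (α : S.QCA) (x y : ℤ), y ≤ x →
        S.leftAlgebra τ y ≤ S.imageLeftAlgebra τ hτ α x →
          QCAIndex.jonesIndex (QCAIndex.gnsVector τ) (S.imageLeftAlgebra τ hτ α x)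
            (S.leftAlgebra τ y) < ⊤ ∧
          QCAIndex.jonesIndex (QCAIndex.gnsVector τ) (S.leftAlgebra τ x)
            (S.leftAlgebra τ y) < ⊤ ∧
          (ind α : ℝ) = S.indexRatio τ hτ α x y) ∧
      S.FDQC ≤ ind.ker := by
  have hex : ∀ (α : S.QCA) (x : ℤ), ∃ y ≤ x, S.leftAlgebra τ y ≤ S.imageLeftAlgebra τ hτ α x :=
    fun α x => QCAIndex.SpinChain.exists_leftAlgebra_le_imageLeftAlgebra hτ α.2 x
  refine ⟨hex, ?_⟩
  choose y hy hle using hex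
  let ind : S.QCA →* {r : ℝ // 0 < r} := MonoidHom.mk'
    (fun α => ⟨S.indexRatio τ hτ α 0 (y α 0),
      QCAIndex.SpinChain.indexRatio_pos hτ hS α.2 (hy α 0) (hle α 0)⟩) fun α β => by
    apply Subtype.ext
    have hyz := hy α (y β 0)
    have hzx := hy β 0
    have h₁ := hle α (y β 0)
    have h₂ := hle β 0
    -- `z = y β 0` serves as the intermediate site for the product, and `(0, y α z)` is then
    -- admissible for `α * β`.
    have himage : S.leftAlgebra τ (y α (y β 0)) ≤ S.imageLeftAlgebra τ hτ (α * β : S.QCA) 0 := by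
      refine h₁.trans ?_
      rw [QCAIndex.SpinChain.imageLeftAlgebra, QCAIndex.SpinChain.imageLeftAlgebra,
        Subgroup.coe_mul, QCAIndex.vonNeumannMap_extend_mul]
      exact QCAIndex.vonNeumannMap_mono h₂ _
    change S.indexRatio τ hτ (α * β : S.QCA) 0 (y (α * β) 0)
      = S.indexRatio τ hτ α 0 (y α 0) * S.indexRatio τ hτ β 0 (y β 0)
    rw [QCAIndex.SpinChain.indexRatio_eq hτ hS (α * β : S.QCA).2 (hy _ 0) (hle _ 0)
        (hyz.trans hzx) himage,
      QCAIndex.SpinChain.indexRatio_eq hτ hS α.2 (hy α 0) (hle α 0) hyz h₁]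
    exact QCAIndex.SpinChain.indexRatio_mul hτ hS α.2 β.2 hyz hzx h₁ h₂
  have hind : ∀ (α : S.QCA) (x y : ℤ), y ≤ x → S.leftAlgebra τ y ≤ S.imageLeftAlgebra τ hτ α x →
      (ind α : ℝ) = S.indexRatio τ hτ α x y := fun α x y' hyx h =>
    QCAIndex.SpinChain.indexRatio_eq hτ hS α.2 (hy α 0) (hle α 0) hyx h
  have hle_one : ∀ α : S.QCA, S.IsDepthOneCircuit α → (ind α : ℝ) ≤ 1 := by
    intro α hα
    obtain ⟨x, hx⟩ := hα.exists_cut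
    rw [hind α x _ (hy α x) (hle α x)]
    refine QCAIndex.SpinChain.indexRatio_le_one hτ hS (hy α x) (hle α x)
      (QCAIndex.SpinChain.imageLeftAlgebra_le hτ fun I hI a ha => ?_)
    obtain ⟨J, hJ, haJ⟩ := hx I hI a ha
    exact QCAIndex.SpinChain.gns_mem_leftAlgebra hJ haJ
  -- `ind α` and `ind α⁻¹` are positive, at most `1`, and have product `1`.
  have hone : ∀ α : S.QCA, S.IsDepthOneCircuit α → ind α = 1 := by
    intro α hα
    have h1 := hle_one α hα
    have h2 := hle_one α⁻¹ hα.inv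
    have h3 : (ind α : ℝ) * (ind α⁻¹ : ℝ) = 1 := by
      have := congrArg Subtype.val (map_mul ind α α⁻¹)
      rw [mul_inv_cancel, map_one] at this
      exact this.symm
    apply Subtype.ext
    change (ind α : ℝ) = 1
    nlinarith [(ind α).2, (ind α⁻¹).2]
  refine ⟨ind, fun α x y' hyx h =>
    ⟨QCAIndex.SpinChain.jonesIndex_imageLeftAlgebra_lt_top hτ hS α.2 hyx h,
      QCAIndex.SpinChain.jonesIndex_leftAlgebra_lt_top hτ hS hyx, hind α x y' hyx h⟩, ?_⟩
  rintro α ⟨L, hL, hprod⟩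
  rw [MonoidHom.mem_ker]
  induction L generalizing α with
  | nil =>
    have : α = 1 := Subtype.ext hprod.symm
    rw [this, map_one]
  | cons β L ih =>
    have hβ := hL β List.mem_cons_self
    -- Splitting off the first layer within `S.QCA` needs that layer to be a QCA itself.
    let β' : S.QCA := ⟨β, hβ.mem_QCA⟩
    have h1 : ind (β'⁻¹ * α) = 1 := by
      refine ih (fun γ hγ => hL γ (List.mem_cons_of_mem _ hγ)) ?_
      rw [Subgroup.coe_mul, ← hprod, List.prod_cons]
      exact (inv_mul_cancel_left β L.prod).symm
    rw [← mul_inv_cancel_left β' α, map_mul, h1, hone β' hβ, mul_one]
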